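/- Let $q,r>0$ be real numbers and let $$D=\{z=(z_1,z_2,z_3)\in\mathbb{C}^3 : |z_1|^2+|z_2|^q<1,\ |z_1|^2+|z_3|^r<1\}.$$ Let $L^2_a(D)$ be the space of holomorphic functions on $D$ that are square integrable with respect to Lebesgue measure, and let $K_D(z,w)=\sum_{j\ge 0}\phi_j(z)\overline{\phi_j(w)}$, for any complete orthonormal basis $(\phi_j)_{j\ge0}$ of $L^2_a(D)$, be the Bergman kernel of $D$. For $z,w\in D$ put $$\nu_i=z_i\overline{w_i}\ (i=1,2,3),\qquad \mu_2=\frac{\nu_2}{(1-\nu_1)^{2/q}},\qquad \mu_3=\frac{\nu_3}{(1-\nu_1)^{2/r}},$$ with principal powers. Then $\operatorname{Re}(1-\nu_1)>0$, $\mu_2\ne1$, $\mu_3\neq 1$, and $$K_D(z,w)=\frac{qr(1-\mu_2)(1-\mu_3)+2q(1-\mu_2)(1+\mu_3)+2r(1+\mu_2)(1-\mu_3)}{\pi^3\,q\,r\,(1-\nu_1)^{2+2/q+2/r}\,(1-\mu_2)^3(1-\mu_3)^3}\qquad\text{for all } z,w\in D.$$ -/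

import Mathlib

open MeasureTheory ComplexConjugate

/-- The Bergman space `L²_a(D)` of a set `D ⊆ ℂⁿ`: the square integrable functions on `D` (with
respect to Lebesgue measure, which is the `volume` of `Fin n → ℂ`) that are holomorphic on `D`,
as a subspace of the Hilbert space `L²(D)`, with the inherited inner product. -/
def bergmanSpace {n : ℕ} (D : Set (Fin n → ℂ)) :
    Submodule ℂ (Lp ℂ 2 (volume.restrict D)) where
  carrier := {f | ∃ g : (Fin n → ℂ) → ℂ, DifferentiableOn ℂ g D ∧ f =ᵐ[volume.restrict D] g}
  add_mem' := by
    rintro f₁ f₂ ⟨g₁, hg₁, h₁⟩ ⟨g₂, hg₂, h₂⟩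
    exact ⟨g₁ + g₂, hg₁.add hg₂, (Lp.coeFn_add f₁ f₂).trans (h₁.add h₂)⟩
  zero_mem' := ⟨0, differentiableOn_const 0, Lp.coeFn_zero _ _ _⟩
  smul_mem' := by
    rintro c f ⟨g, hg, h⟩
    exact ⟨c • g, hg.const_smul c, (Lp.coeFn_smul c f).trans (h.const_smul c)⟩

/-- The holomorphic representative of an element of the Bergman space (for open `D` its values on
`D` are uniquely determined). -/
noncomputable def holRep {n : ℕ} {D : Set (Fin n → ℂ)} (f : bergmanSpace D) :
    (Fin n → ℂ) → ℂ :=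
  Classical.choose f.2

/-- `K` is the Bergman kernel of `D`: the Bergman space has a complete orthonormal basis
`φ₀, φ₁, …`, and for every such basis `K(z, w) = ∑ⱼ φⱼ(z) * conj (φⱼ(w))` for all `z, w ∈ D`. -/
def IsBergmanKernel {n : ℕ} (D : Set (Fin n → ℂ))
    (K : (Fin n → ℂ) → (Fin n → ℂ) → ℂ) : Prop :=
  Nonempty (HilbertBasis ℕ ℂ (bergmanSpace D)) ∧
    ∀ φ : HilbertBasis ℕ ℂ (bergmanSpace D), ∀ z ∈ D, ∀ w ∈ D,
      HasSum (fun j : ℕ => holRep (φ j) z * conj (holRep (φ j) w)) (K z w)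

/-- The intersection of two complex ellipsoids
`{z ∈ ℂ³ : |z₁|² + |z₂|^q < 1, |z₁|² + |z₃|^r < 1}` (coordinates are numbered from `0`). -/
def ellipsoidIntersection (q r : ℝ) : Set (Fin 3 → ℂ) :=
  {z | ‖z 0‖ ^ 2 + ‖z 1‖ ^ q < 1 ∧ ‖z 0‖ ^ 2 + ‖z 2‖ ^ r < 1}

/-- `ν = zᵢ * conj wᵢ`. -/
noncomputable def nu (z w : Fin 3 → ℂ) (i : Fin 3) : ℂ := z i * conj (w i)

/-- `μ = νᵢ / (1 - ν₁) ^ (2 / s)`, where `ν₁` belongs to the first coordinate and the power is the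
principal one; `s = q` for the second coordinate and `s = r` for the third. -/
noncomputable def mu (s : ℝ) (z w : Fin 3 → ℂ) (i : Fin 3) : ℂ :=
  nu z w i / (1 - nu z w 0) ^ ((2 / s : ℝ) : ℂ)

/-! The domain is a bounded complete Reinhardt domain, so invariance under rotating each coordinate
makes the monomials orthogonal in `L²(D)`. The kernel is then the sum of `zᵖ * conj (wᵖ) / ‖zᵖ‖²`,
provided the normalized monomials are complete and the sum is independent of the basis.

Completeness: `integral_mul_conj_coordMonomial` shows that the inner product with a monomial reads
off a Taylor coefficient, so a function orthogonal to all monomials has zero Taylor series and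
vanishes. The point evaluation bound `norm_le_sqrt_mul_norm` makes the Bergman space closed.
Independence of the basis (`isBergmanKernel_of_hasSum`): evaluation at `z` is the inner product with
some `k_z`, and Parseval expands `⟨k_z, k_w⟩` in any basis.

For this domain, slicing at fixed `z₀` gives a product of two discs, and the norms reduce to a Beta
integral (`monomialNormSq_ellipsoidIntersection`). The series is summed first over the exponent of
`z₀`, by the binomial series; this produces the powers of `1 - ν₁` and turns `ν₂`, `ν₃` into `μ₂`,
`μ₃`. Two differentiated geometric series remain (`hasSum_kernelTerm`). -/

/-! ### Cauchy estimates, locally uniform limits and partial derivatives in several complex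
variables -/

open Metric Filter Topology in
/-- Cauchy's estimate for the derivative of a holomorphic function on a ball. -/
theorem norm_fderiv_le_of_forall_mem_ball {E F : Type*} [NormedAddCommGroup E] [NormedSpace ℂ E]
    [NormedAddCommGroup F] [NormedSpace ℂ F] {f : E → F} {x : E} {r M : ℝ} (hr : 0 < r)
    (hf : DifferentiableOn ℂ f (ball x r)) (hM : ∀ y ∈ ball x r, ‖f y‖ ≤ M) :
    ‖fderiv ℂ f x‖ ≤ 2 * M / r := by
  have hM0 : 0 ≤ M := (norm_nonneg _).trans (hM x (mem_ball_self hr))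
  refine ContinuousLinearMap.opNorm_le_bound _ (by positivity) fun v => ?_
  rcases eq_or_ne v 0 with rfl | hv
  · simp
  have hv' : 0 < ‖v‖ := norm_pos_iff.2 hv
  -- Half the largest admissible radius, so that the closed disc of `t` stays inside the open ball;
  -- this is the source of the factor 2 in the bound.
  set ρ : ℝ := r / (2 * ‖v‖) with hρ
  have hρ0 : 0 < ρ := by positivity
  have hmem : ∀ t : ℂ, t ∈ closedBall (0 : ℂ) ρ → x + t • v ∈ ball x r := by
    intro t ht
    rw [mem_closedBall_zero_iff] at ht
    rw [mem_ball, dist_eq_norm, add_sub_cancel_left, norm_smul]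
    calc ‖t‖ * ‖v‖ ≤ ρ * ‖v‖ := by gcongr
      _ = r / 2 := by rw [hρ]; field_simp
      _ < r := by linarith
  have hx : HasFDerivAt f (fderiv ℂ f x) (x + (0 : ℂ) • v) := by
    rw [zero_smul, add_zero]
    exact (hf.differentiableAt (ball_mem_nhds x hr)).hasFDerivAt
  have hline : ∀ t : ℂ, HasDerivAt (fun t : ℂ => x + t • v) v t := fun t => by
    simpa using ((hasDerivAt_id t).smul_const v).const_add x
  have hd : HasDerivAt (fun t : ℂ => f (x + t • v)) (fderiv ℂ f x v) 0 :=
    hx.comp_hasDerivAt 0 (hline 0)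
  have hdiff : DifferentiableOn ℂ (fun t : ℂ => f (x + t • v)) (closedBall 0 ρ) :=
    fun t ht => ((hf.differentiableAt (isOpen_ball.mem_nhds (hmem t ht))).comp t
      (hline t).differentiableAt).differentiableWithinAt
  have := Complex.norm_deriv_le_of_forall_mem_sphere_norm_le hρ0
    (hdiff.diffContOnCl_ball subset_rfl) (fun t ht => hM _ (hmem t (sphere_subset_closedBall ht)))
  rw [hd.deriv] at this
  refine this.trans (le_of_eq ?_)
  rw [hρ]; field_simp

open Metric Filter Topology in
/-- A locally uniform limit of holomorphic functions is holomorphic. -/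
theorem differentiableOn_of_locally_tendstoUniformlyOn {E F ι : Type*} [NormedAddCommGroup E]
    [NormedSpace ℂ E] [NormedAddCommGroup F] [NormedSpace ℂ F] [CompleteSpace F]
    {f : ι → E → F} {g : E → F} {l : Filter ι} [l.NeBot] {U : Set E} (hU : IsOpen U)
    (hf : ∀ n, DifferentiableOn ℂ (f n) U)
    (hfg : ∀ x ∈ U, ∃ t ∈ 𝓝 x, TendstoUniformlyOn f g l t) : DifferentiableOn ℂ g U := by
  intro x hx
  obtain ⟨t, ht, hlim⟩ := hfg x hx
  obtain ⟨R, hR, hball⟩ := Metric.mem_nhds_iff.1 (inter_mem ht (hU.mem_nhds hx))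
  set r := R / 2 with hr
  have hr0 : 0 < r := by positivity
  have hsub : ∀ y ∈ ball x r, ball y r ⊆ ball x R := fun y hy z hz => by
    rw [mem_ball] at *
    linarith [dist_triangle z y x]
  have hself : ball x r ⊆ ball x R := ball_subset_ball (by linarith)
  have hder : ∀ n, ∀ y ∈ ball x R, DifferentiableAt ℂ (f n) y := fun n y hy =>
    (hf n).differentiableAt (hU.mem_nhds (hball hy).2)
  have hC : UniformCauchySeqOn (fun n => fderiv ℂ (f n)) l (ball x r) := by
    intro u hu
    obtain ⟨ε, hε, hεu⟩ := Metric.mem_uniformity_dist.1 hu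
    -- With difference at most `ε * r / 4`, the Cauchy estimate on balls of radius `r` bounds the
    -- difference of derivatives by `ε / 2`.
    have hc := (hlim.mono fun z hz => (hball hz).1).uniformCauchySeqOn _
      (Metric.dist_mem_uniformity (show 0 < ε * r / 4 by positivity))
    filter_upwards [hc] with m hm y hy
    refine hεu ?_
    have hy' := hself hy
    rw [dist_eq_norm, ← fderiv_sub (hder _ y hy') (hder _ y hy')]
    have := norm_fderiv_le_of_forall_mem_ball (f := f m.1 - f m.2) (x := y) (M := ε * r / 4) hr0
      (fun z hz => ((hder _ z (hsub y hy hz)).sub (hder _ z (hsub y hy hz))).differentiableWithinAt)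
      (fun z hz => by
        have h := hm z (hsub y hy hz)
        simp only [dist_eq_norm] at h
        exact h.le)
    refine this.trans_lt ?_
    rw [div_lt_iff₀ hr0]
    nlinarith [mul_pos hε hr0]
  have hex : ∀ y ∈ ball x r, ∃ L, Tendsto (fun n => fderiv ℂ (f n) y) l (𝓝 L) := fun y hy =>
    cauchy_map_iff_exists_tendsto.1 (hC.cauchy_map hy)
  choose! g' hg' using hex
  exact (hasFDerivAt_of_tendstoUniformlyOn isOpen_ball (hC.tendstoUniformlyOn_of_tendsto hg')
    (fun n y hy => (hder n y (hself hy)).hasFDerivAt)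
    (fun y hy => hlim.tendsto_at (hball (hself hy)).1)
    (mem_ball_self hr0)).differentiableAt.differentiableWithinAt

/-- The partial derivative of `F` with respect to the `i`-th complex coordinate. -/
noncomputable def pderivCoord {ι : Type*} [DecidableEq ι] (i : ι) (F : (ι → ℂ) → ℂ) (z : ι → ℂ) :
    ℂ :=
  deriv (fun t : ℂ => F (Function.update z i t)) (z i)

theorem update_add_eq_add_single {ι : Type*} [DecidableEq ι] (z : ι → ℂ) (i : ι) (t : ℂ) :
    Function.update z i (z i + t) = z + Pi.single i t := by
  ext j
  rcases eq_or_ne j i with rfl | h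
  · simp
  · simp [h]

open Metric Filter Topology in
/-- The partial derivatives of a holomorphic function are holomorphic. -/
theorem differentiableOn_pderivCoord {n : ℕ} {F : (Fin n → ℂ) → ℂ} {U : Set (Fin n → ℂ)}
    (hU : IsOpen U) (hF : DifferentiableOn ℂ F U) (i : Fin n) :
    DifferentiableOn ℂ (pderivCoord i F) U := by
  intro x hx
  obtain ⟨R, hR, hRU⟩ := Metric.isOpen_iff.1 hU x hx
  -- A point near `x`, a shift along coordinate `i` and a Cauchy ball cost `r` each; all of this
  -- must fit in a compact ball inside `U`.
  obtain ⟨r, hr⟩ : ∃ r, r = R / 5 := ⟨_, rfl⟩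
  have hr0 : 0 < r := by rw [hr]; positivity
  have hK : IsCompact (closedBall x (4 * r)) := isCompact_closedBall _ _
  have hKU : closedBall x (4 * r) ⊆ U := (closedBall_subset_ball (by linarith)).trans hRU
  obtain ⟨M, hM⟩ := hK.exists_bound_of_continuousOn (hF.continuousOn.mono hKU)
  have hnorm : ∀ t : ℂ, ‖(Pi.single i t : Fin n → ℂ)‖ = ‖t‖ := fun t =>
    Pi.norm_single (G := fun _ : Fin n => ℂ) t
  have hball : ∀ z ∈ ball x r, ∀ t : ℂ, ‖t‖ ≤ r → ball (z + Pi.single i t) r ⊆ closedBall x (4 * r) := by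
    intro z hz t ht y hy
    rw [mem_ball, dist_eq_norm] at hz hy
    rw [mem_closedBall, dist_eq_norm]
    calc ‖y - x‖ = ‖(y - (z + Pi.single i t)) + (z - x) + Pi.single i t‖ := by congr 1; abel
      _ ≤ ‖y - (z + Pi.single i t)‖ + ‖z - x‖ + ‖(Pi.single i t : Fin n → ℂ)‖ := norm_add₃_le
      _ ≤ 4 * r := by rw [hnorm]; linarith
  have hda : ∀ z ∈ ball x r, ∀ t : ℂ, ‖t‖ ≤ r → DifferentiableAt ℂ F (z + Pi.single i t) :=
    fun z hz t ht => hF.differentiableAt (hU.mem_nhds (hKU (hball z hz t ht (mem_ball_self hr0))))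
  have hsingle : Differentiable ℂ (fun t : ℂ => (Pi.single i t : Fin n → ℂ)) :=
    (ContinuousLinearMap.single ℂ (fun _ : Fin n => ℂ) i).differentiable
  have hcircle : ∀ θ : ℝ, ‖circleMap 0 r θ‖ ≤ r := fun θ => by simp [abs_of_pos hr0]
  -- The weight `dt / (2πi t²)` of Cauchy's formula for a first derivative. The circle does not
  -- depend on `z`, so the formula can be differentiated under the integral sign.
  set c : ℝ → ℂ := fun θ => (2 * Real.pi * Complex.I)⁻¹ *
    (deriv (circleMap 0 r) θ * (1 / (circleMap 0 r θ) ^ 2)) with hc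
  have hcc : Continuous c := by
    have h0 : ∀ θ, circleMap 0 r θ ^ 2 ≠ 0 := fun θ => pow_ne_zero _ (circleMap_ne_center hr0.ne')
    simp only [hc, deriv_circleMap]
    fun_prop (disch := exact h0 _)
  have hformula : ∀ z ∈ ball x r, pderivCoord i F z =
      ∫ θ in (0 : ℝ)..2 * Real.pi, c θ * F (z + Pi.single i (circleMap 0 r θ)) := by
    intro z hz
    have hg : DifferentiableOn ℂ (fun t : ℂ => F (z + Pi.single i t)) (closedBall 0 r) := by
      intro t ht
      rw [mem_closedBall_zero_iff] at ht
      exact ((hda z hz t ht).comp t ((hsingle t).const_add z)).differentiableWithinAt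
    have h := hg.deriv_eq_smul_circleIntegral hr0
    have h2 : pderivCoord i F z = deriv (fun t : ℂ => F (z + Pi.single i t)) 0 := by
      have := deriv_comp_const_add (fun t : ℂ => F (Function.update z i t)) (z i) 0
      simp only [update_add_eq_add_single, add_zero] at this
      exact this.symm
    have hpi : (2 * Real.pi * Complex.I : ℂ) ≠ 0 := by simp [Real.pi_ne_zero]
    have h3 : deriv (fun t : ℂ => F (z + Pi.single i t)) 0 = (2 * Real.pi * Complex.I : ℂ)⁻¹ *
        ∮ t in C(0, r), (1 / (t - 0) ^ 2) • F (z + Pi.single i t) := by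
      rw [h, smul_eq_mul, inv_mul_cancel_left₀ hpi]
    rw [h2, h3, circleIntegral, ← intervalIntegral.integral_const_mul]
    refine intervalIntegral.integral_congr fun θ _ => ?_
    simp [hc]
    ring
  have hcont : ∀ z ∈ ball x r, Continuous fun θ => c θ * F (z + Pi.single i (circleMap 0 r θ)) := by
    intro z hz
    refine hcc.mul (hF.continuousOn.comp_continuous ?_
      fun θ => hKU (hball z hz _ (hcircle θ) (mem_ball_self hr0)))
    exact continuous_const.add (hsingle.continuous.comp (continuous_circleMap 0 r))
  have hmem : ball x r ∈ 𝓝 x := ball_mem_nhds x hr0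
  have hmeas : AEStronglyMeasurable (fun θ => c θ • fderiv ℂ F (x + Pi.single i (circleMap 0 r θ)))
      (volume.restrict (Set.uIoc 0 (2 * Real.pi))) := by
    have h : Measurable fun θ => fderiv ℂ F (x + Pi.single i (circleMap 0 r θ)) :=
      (measurable_fderiv ℂ F).comp
        (continuous_const.add (hsingle.continuous.comp (continuous_circleMap 0 r))).measurable
    have hfin : FiniteDimensional ℂ ((Fin n → ℂ) →L[ℂ] ℂ) := inferInstance
    have hprop : ProperSpace ((Fin n → ℂ) →L[ℂ] ℂ) := FiniteDimensional.proper ℂ _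
    have hsc : SecondCountableTopology ((Fin n → ℂ) →L[ℂ] ℂ) := secondCountable_of_proper
    exact hcc.aestronglyMeasurable.smul h.aestronglyMeasurable
  clear_value c
  have haux : ∀ (a : ℂ) (L : (Fin n → ℂ) →L[ℂ] ℂ) (B : ℝ), ‖L‖ ≤ B → ‖a • L‖ ≤ ‖a‖ * B := by
    intro a L B h
    rw [norm_smul]
    exact mul_le_mul_of_nonneg_left h (norm_nonneg a)
  have hbound : ∀ θ : ℝ, ∀ z ∈ ball x r,
      ‖c θ • fderiv ℂ F (z + Pi.single i (circleMap 0 r θ))‖ ≤ ‖c θ‖ * (2 * M / r) := by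
    intro θ z hz
    have h : ‖fderiv ℂ F (z + Pi.single i (circleMap 0 r θ))‖ ≤ 2 * M / r :=
      norm_fderiv_le_of_forall_mem_ball hr0 (hF.mono ((hball z hz _ (hcircle θ)).trans hKU))
        fun y hy => hM y (hball z hz _ (hcircle θ) hy)
    exact haux (c θ) _ _ h
  have hderiv : ∀ θ : ℝ, ∀ z ∈ ball x r,
      HasFDerivAt (fun z => c θ * F (z + Pi.single i (circleMap 0 r θ)))
        (c θ • fderiv ℂ F (z + Pi.single i (circleMap 0 r θ))) z := by
    intro θ z hz
    have h := (hda z hz _ (hcircle θ)).hasFDerivAt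
    exact ((hasFDerivAt_comp_add_right _).2 h).const_mul (c θ)
  have key : ∀ G' : (Fin n → ℂ) → ℝ → (Fin n → ℂ) →L[ℂ] ℂ,
      AEStronglyMeasurable (G' x) (volume.restrict (Set.uIoc 0 (2 * Real.pi))) →
      (∀ θ : ℝ, ∀ z ∈ ball x r, ‖G' z θ‖ ≤ ‖c θ‖ * (2 * M / r)) →
      (∀ θ : ℝ, ∀ z ∈ ball x r,
        HasFDerivAt (fun z => c θ * F (z + Pi.single i (circleMap 0 r θ))) (G' z θ) z) →
      DifferentiableAt ℂ (fun z => ∫ θ in (0 : ℝ)..2 * Real.pi,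
        c θ * F (z + Pi.single i (circleMap 0 r θ))) x := by
    intro G' h1 h2 h3
    exact (intervalIntegral.hasFDerivAt_integral_of_dominated_of_fderiv_le hmem
      (by filter_upwards [hmem] with z hz using (hcont z hz).aestronglyMeasurable)
      ((hcont x (mem_ball_self hr0)).intervalIntegrable _ _) h1
      (Eventually.of_forall fun θ _ z hz => h2 θ z hz)
      ((hcc.norm.mul continuous_const).intervalIntegrable _ _)
      (Eventually.of_forall fun θ _ z hz => h3 θ z hz)).differentiableAt
  refine ((key _ hmeas hbound hderiv).congr_of_eventuallyEq ?_).differentiableWithinAt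
  filter_upwards [hmem] with z hz using hformula z hz

/-! ### Complete Reinhardt sets and Taylor coefficients in one coordinate -/

/-- A set of `ℂⁿ` is a complete Reinhardt set if with each point `z` it contains the closed
polydisc of polyradius `(|z₁|, …, |zₙ|)`. -/
def IsCompleteReinhardt {n : ℕ} (D : Set (Fin n → ℂ)) : Prop :=
  ∀ z ∈ D, ∀ w : Fin n → ℂ, (∀ i, ‖w i‖ ≤ ‖z i‖) → w ∈ D

/-- The coefficient of `tᵏ` in the Taylor expansion at `0` of `F` in the `i`-th variable. -/
noncomputable def coordCoeff {ι : Type*} [DecidableEq ι] (i : ι) (k : ℕ) (F : (ι → ℂ) → ℂ)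
    (z : ι → ℂ) : ℂ :=
  (pderivCoord i)^[k] F (Function.update z i 0) / k.factorial

section Independence

variable {ι : Type*} [DecidableEq ι]

theorem iterate_pderivCoord_update (i : ι) (k : ℕ) (F : (ι → ℂ) → ℂ) (z : ι → ℂ) :
    (fun t => (pderivCoord i)^[k] F (Function.update z i t)) =
      iteratedDeriv k (fun t => F (Function.update z i t)) := by
  induction k with
  | zero => simp
  | succ k ih =>
    rw [iteratedDeriv_succ, ← ih]
    ext t
    rw [Function.iterate_succ_apply', pderivCoord]
    simp

theorem coordCoeff_eq_iteratedDeriv (i : ι) (k : ℕ) (F : (ι → ℂ) → ℂ) (z : ι → ℂ) :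
    coordCoeff i k F z = iteratedDeriv k (fun t => F (Function.update z i t)) 0 / k.factorial := by
  rw [coordCoeff, ← iterate_pderivCoord_update]

theorem coordCoeff_update_self (i : ι) (k : ℕ) (F : (ι → ℂ) → ℂ) (z : ι → ℂ) (t : ℂ) :
    coordCoeff i k F (Function.update z i t) = coordCoeff i k F z := by
  simp [coordCoeff]

theorem coordCoeff_update_of_ne {i j : ι} (hij : i ≠ j) (k : ℕ) {F : (ι → ℂ) → ℂ}
    (hF : ∀ z t, F (Function.update z j t) = F z) (z : ι → ℂ) (t : ℂ) :
    coordCoeff i k F (Function.update z j t) = coordCoeff i k F z := by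
  rw [coordCoeff_eq_iteratedDeriv, coordCoeff_eq_iteratedDeriv]
  congr 2
  ext s
  rw [Function.update_comm hij.symm, hF]

end Independence

section Reinhardt

variable {n : ℕ} {D : Set (Fin n → ℂ)} {F : (Fin n → ℂ) → ℂ}

theorem IsCompleteReinhardt.update_mem (hR : IsCompleteReinhardt D) {z : Fin n → ℂ} (hz : z ∈ D)
    {i : Fin n} {t : ℂ} (ht : ‖t‖ ≤ ‖z i‖) : Function.update z i t ∈ D := by
  refine hR z hz _ fun j => ?_
  rcases eq_or_ne j i with rfl | h
  · simpa using ht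
  · simp [h]

theorem differentiableOn_coordCoeff (hD : IsOpen D) (hR : IsCompleteReinhardt D)
    (hF : DifferentiableOn ℂ F D) (i : Fin n) (k : ℕ) :
    DifferentiableOn ℂ (coordCoeff i k F) D := by
  have h : DifferentiableOn ℂ ((pderivCoord i)^[k] F) D := by
    induction k with
    | zero => simpa using hF
    | succ k ih =>
      rw [Function.iterate_succ_apply']
      exact differentiableOn_pderivCoord hD ih i
  have hu : Differentiable ℂ (fun z : Fin n → ℂ => Function.update z i 0) := by
    rw [differentiable_pi]
    intro j
    rcases eq_or_ne j i with rfl | hj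
    · simp
    · simp only [Function.update_of_ne hj]
      fun_prop
  have h2 : DifferentiableOn ℂ (fun z => (pderivCoord i)^[k] F (Function.update z i 0)) D :=
    h.comp hu.differentiableOn fun z hz => hR.update_mem hz (by simp)
  have h3 : coordCoeff i k F =
      fun z => (k.factorial : ℂ)⁻¹ * (pderivCoord i)^[k] F (Function.update z i 0) :=
    funext fun z => div_eq_inv_mul _ _
  rw [h3]
  exact h2.const_mul _

theorem hasSum_coordCoeff (hD : IsOpen D) (hR : IsCompleteReinhardt D)
    (hF : DifferentiableOn ℂ F D) (i : Fin n) {z : Fin n → ℂ} (hz : z ∈ D) :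
    HasSum (fun k => coordCoeff i k F z * z i ^ k) (F z) := by
  have hcont : Continuous fun t : ℂ => Function.update z i t := continuous_const.update i continuous_id
  have hopen : IsOpen {s : ℝ | Function.update z i (s : ℂ) ∈ D} :=
    hD.preimage (hcont.comp Complex.continuous_ofReal)
  have hmem : ‖z i‖ ∈ {s : ℝ | Function.update z i (s : ℂ) ∈ D} :=
    hR.update_mem hz (by simp)
  -- Openness allows a slightly larger modulus in coordinate `i`, which puts `z i` strictly inside
  -- the disc on which the Taylor series converges.
  obtain ⟨ε, hε, hball⟩ := Metric.isOpen_iff.1 hopen _ hmem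
  have hs : Function.update z i ((‖z i‖ + ε / 2 : ℝ) : ℂ) ∈ D := by
    refine hball ?_
    rw [Metric.mem_ball, Real.dist_eq, add_sub_cancel_left, abs_of_pos (by positivity)]
    linarith
  have hs0 : 0 ≤ ‖z i‖ + ε / 2 := by positivity
  have hdiff : DifferentiableOn ℂ (fun t => F (Function.update z i t))
      (Metric.ball 0 (‖z i‖ + ε / 2)) := by
    have hu : Differentiable ℂ (fun t : ℂ => Function.update z i t) := by
      rw [differentiable_pi]
      intro j
      rcases eq_or_ne j i with rfl | hj
      · simp
      · simp [Function.update_of_ne hj]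
    refine hF.comp hu.differentiableOn fun t ht => ?_
    rw [mem_ball_zero_iff] at ht
    have := hR.update_mem (i := i) (t := t) hs (by
      rw [Function.update_self, Complex.norm_real, Real.norm_of_nonneg hs0]; exact ht.le)
    simpa using this
  have h := Complex.hasSum_taylorSeries_on_ball hdiff (z := z i) (by
    rw [mem_ball_zero_iff]; linarith)
  simp only [Function.update_eq_self, sub_zero] at h
  refine h.congr_fun fun k => ?_
  rw [coordCoeff_eq_iteratedDeriv, smul_eq_mul, smul_eq_mul]
  ring

theorem integral_exp_int_mul_I (m : ℤ) :
    ∫ θ in (0 : ℝ)..2 * Real.pi, Complex.exp (m * θ * Complex.I) =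
      if m = 0 then 2 * Real.pi else 0 := by
  split_ifs with h
  · simp [h]
  · have hc : (m * Complex.I : ℂ) ≠ 0 := by simp [h]
    have h1 := integral_exp_mul_complex (a := 0) (b := 2 * Real.pi) hc
    have h2 : ∀ θ : ℝ, (m * θ * Complex.I : ℂ) = m * Complex.I * θ := fun θ => by ring
    simp only [h2, h1]
    have h3 : (m * Complex.I * ((2 * Real.pi : ℝ) : ℂ)) = m * (2 * Real.pi * Complex.I) := by
      push_cast; ring
    rw [h3, Complex.exp_int_mul_two_pi_mul_I]
    simp

/-- On the circle the Taylor series in `z i` is a Fourier series, dominated by its absolutely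
convergent value at `z`; termwise integration keeps only the frequency `k`. -/
theorem integral_rotate_mul_exp (hD : IsOpen D) (hR : IsCompleteReinhardt D)
    (hF : DifferentiableOn ℂ F D) (i : Fin n) (k : ℕ) {z : Fin n → ℂ} (hz : z ∈ D) :
    ∫ θ in (0 : ℝ)..2 * Real.pi,
      F (Function.update z i (Complex.exp (θ * Complex.I) * z i)) *
        Complex.exp (-(k * θ * Complex.I)) = 2 * Real.pi * (coordCoeff i k F z * z i ^ k) := by
  have hmem : ∀ θ : ℝ, Function.update z i (Complex.exp (θ * Complex.I) * z i) ∈ D := fun θ =>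
    hR.update_mem hz (by simp [Complex.norm_exp_ofReal_mul_I])
  have hsum : ∀ θ : ℝ, HasSum (fun m : ℕ => coordCoeff i m F z * z i ^ m *
      Complex.exp (((m - k : ℤ) : ℂ) * θ * Complex.I))
      (F (Function.update z i (Complex.exp (θ * Complex.I) * z i)) *
        Complex.exp (-(k * θ * Complex.I))) := by
    intro θ
    have h := (hasSum_coordCoeff hD hR hF i (hmem θ)).mul_right (Complex.exp (-(k * θ * Complex.I)))
    refine h.congr_fun fun m => ?_
    rw [coordCoeff_update_self, Function.update_self, mul_pow, ← Complex.exp_nat_mul]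
    have : Complex.exp (((m - k : ℤ) : ℂ) * θ * Complex.I) =
        Complex.exp (m * (θ * Complex.I)) * Complex.exp (-(k * θ * Complex.I)) := by
      rw [← Complex.exp_add]; congr 1; push_cast; ring
    rw [this]; ring
  have hsummable : Summable fun m : ℕ => ‖coordCoeff i m F z * z i ^ m‖ :=
    (hasSum_coordCoeff hD hR hF i hz).summable.norm
  have h1 := intervalIntegral.hasSum_integral_of_dominated_convergence (μ := volume)
    (a := 0) (b := 2 * Real.pi)
    (fun m (_ : ℝ) => ‖coordCoeff i m F z * z i ^ m‖)
    (F := fun (m : ℕ) (θ : ℝ) => coordCoeff i m F z * z i ^ m *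
      Complex.exp (((m - k : ℤ) : ℂ) * θ * Complex.I))
    (fun m => (by fun_prop : Continuous _).aestronglyMeasurable)
    (fun m => Filter.Eventually.of_forall fun θ _ => by
      rw [norm_mul]
      have : (((m - k : ℤ) : ℂ) * θ * Complex.I) = ((((m - k : ℤ) : ℝ) * θ : ℝ) : ℂ) * Complex.I := by
        push_cast; ring
      rw [this, Complex.norm_exp_ofReal_mul_I, mul_one])
    (Filter.Eventually.of_forall fun θ _ => hsummable)
    (by simp)
    (Filter.Eventually.of_forall fun θ _ => hsum θ)
  refine h1.unique ?_
  have h2 : ∀ m : ℕ, ∫ θ in (0 : ℝ)..2 * Real.pi, coordCoeff i m F z * z i ^ m *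
      Complex.exp (((m - k : ℤ) : ℂ) * θ * Complex.I) =
      if m = k then 2 * Real.pi * (coordCoeff i k F z * z i ^ k) else 0 := by
    intro m
    rw [intervalIntegral.integral_const_mul, integral_exp_int_mul_I]
    rcases eq_or_ne m k with rfl | h
    · simp; ring
    · simp [h, sub_eq_zero]
  simp only [h2]
  exact hasSum_ite_eq k _

theorem measurePreserving_mul_restrict (hD : IsOpen D) (hR : IsCompleteReinhardt D)
    {c : Fin n → ℂ} (hc : ∀ j, ‖c j‖ = 1) :
    MeasurePreserving (fun z : Fin n → ℂ => c * z) (volume.restrict D) (volume.restrict D) := by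
  have h1 : MeasurePreserving (fun z : Fin n → ℂ => c * z) volume volume := by
    refine volume_preserving_pi (f := fun j (x : ℂ) => c j * x) fun j => ?_
    have := (rotation ⟨c j, mem_sphere_zero_iff_norm.2 (hc j)⟩).measurePreserving
    simpa using! this
  have h2 := h1.restrict_preimage hD.measurableSet
  have h3 : (fun z : Fin n → ℂ => c * z) ⁻¹' D = D := by
    ext z
    exact ⟨fun h => hR _ h z fun j => by simp [hc], fun h => hR _ h _ fun j => by simp [hc]⟩
  rwa [h3] at h2

theorem update_mul_eq_mul {i : Fin n} (z : Fin n → ℂ) (t : ℂ) :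
    Function.update z i (t * z i) = Function.update (1 : Fin n → ℂ) i t * z := by
  ext j
  rcases eq_or_ne j i with rfl | h
  · simp
  · simp [h]

/-- Integrating a holomorphic function on a complete Reinhardt domain against a weight which is
homogeneous of degree `-k` under rotations of the `i`-th variable only sees the `k`-th Taylor
coefficient in that variable. -/
theorem integral_mul_eq_integral_coordCoeff (hD : IsOpen D) (hR : IsCompleteReinhardt D)
    (hF : DifferentiableOn ℂ F D) (i : Fin n) (k : ℕ) {W : (Fin n → ℂ) → ℂ}
    (hW : ∀ (θ : ℝ) z, W (Function.update z i (Complex.exp (θ * Complex.I) * z i)) =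
      Complex.exp (-(k * θ * Complex.I)) * W z)
    (hFW : IntegrableOn (fun z => F z * W z) D) :
    IntegrableOn (fun z => coordCoeff i k F z * (z i ^ k * W z)) D ∧
      ∫ z in D, F z * W z = ∫ z in D, coordCoeff i k F z * (z i ^ k * W z) := by
  set μ : Measure ℝ := volume.restrict (Set.Ioc 0 (2 * Real.pi)) with hμ
  set ν : Measure (Fin n → ℂ) := volume.restrict D with hν
  -- Averaging over all rotations of coordinate `i` does not change the integral. Fubini on `[0, 2π]
  -- × D` then lets the rotation integral be done first.
  have hΦ : MeasurePreserving (fun p : ℝ × (Fin n → ℂ) =>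
      (p.1, Function.update p.2 i (Complex.exp (p.1 * Complex.I) * p.2 i))) (μ.prod ν)
      (μ.prod ν) := by
    refine (MeasurePreserving.id μ).skew_product (f := id)
      (g := fun (θ : ℝ) (z : Fin n → ℂ) =>
        Function.update z i (Complex.exp (θ * Complex.I) * z i)) ?_ ?_
    · refine Continuous.measurable ?_
      have h1 : Continuous fun p : ℝ × (Fin n → ℂ) => Complex.exp (p.1 * Complex.I) * p.2 i := by
        fun_prop
      exact continuous_snd.update i h1
    · refine Filter.Eventually.of_forall fun θ => ?_
      simp only [update_mul_eq_mul]
      refine (measurePreserving_mul_restrict hD hR fun j => ?_).map_eq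
      rcases eq_or_ne j i with rfl | h
      · simp [Complex.norm_exp_ofReal_mul_I]
      · simp [h]
  have hint : Integrable (fun p : ℝ × (Fin n → ℂ) => F p.2 * W p.2) (μ.prod ν) :=
    Integrable.comp_snd hFW μ
  have hint2 := hΦ.integrable_comp_of_integrable hint
  have hinner : ∀ z ∈ D, ∫ θ, F (Function.update z i (Complex.exp (θ * Complex.I) * z i)) *
      W (Function.update z i (Complex.exp (θ * Complex.I) * z i)) ∂μ =
      2 * Real.pi * (coordCoeff i k F z * (z i ^ k * W z)) := by
    intro z hz
    have h := integral_rotate_mul_exp hD hR hF i k hz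
    rw [intervalIntegral.integral_of_le (by positivity)] at h
    simp only [hW, ← mul_assoc]
    rw [integral_mul_const, h]
    ring
  have hpi : (2 * Real.pi : ℂ) ≠ 0 := by simp [Real.pi_ne_zero]
  have hae : (fun z => ∫ θ, F (Function.update z i (Complex.exp (θ * Complex.I) * z i)) *
      W (Function.update z i (Complex.exp (θ * Complex.I) * z i)) ∂μ) =ᵐ[ν]
      fun z => 2 * Real.pi * (coordCoeff i k F z * (z i ^ k * W z)) := by
    filter_upwards [ae_restrict_mem hD.measurableSet] with z hz using hinner z hz
  constructor
  · have h := (hint2.integral_prod_right.congr hae).const_mul (2 * Real.pi : ℂ)⁻¹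
    refine h.congr (Filter.Eventually.of_forall fun z => ?_)
    simp only
    rw [inv_mul_cancel_left₀ hpi]
  · have h1 : ∫ p, F p.2 * W p.2 ∂(μ.prod ν) = 2 * Real.pi * ∫ z in D, F z * W z := by
      rw [integral_prod _ hint]
      simp only
      rw [integral_const]
      simp [hμ, ← hν, Measure.real, Real.pi_pos.le]
    have h2 : ∫ p, F p.2 * W p.2 ∂(μ.prod ν) =
        2 * Real.pi * ∫ z in D, coordCoeff i k F z * (z i ^ k * W z) := by
      rw [← integral_const_mul, ← integral_congr_ae hae]
      conv_lhs => rw [← hΦ.map_eq]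
      rw [integral_map hΦ.measurable.aemeasurable (by rw [hΦ.map_eq]; exact hint.1)]
      exact integral_prod_symm _ hint2
    exact mul_left_cancel₀ hpi (h1.symm.trans h2)

end Reinhardt

/-! ### Monomials, Taylor coefficients and orthogonality -/

/-- The monomial `z₁ᵇ z₂ᶜ z₀ᵃ` with exponent `p = (b, c, a)`. -/
def coordMonomial (p : ℕ × ℕ × ℕ) (z : Fin 3 → ℂ) : ℂ :=
  z 1 ^ p.1 * z 2 ^ p.2.1 * z 0 ^ p.2.2

/-- The squared `L²(D)` norm of a monomial. -/
noncomputable def monomialNormSq (D : Set (Fin 3 → ℂ)) (p : ℕ × ℕ × ℕ) : ℝ :=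
  ∫ z in D, ‖coordMonomial p z‖ ^ 2

/-- The Taylor coefficients of a holomorphic function on a complete Reinhardt domain. -/
noncomputable def taylorCoeff (F : (Fin 3 → ℂ) → ℂ) (p : ℕ × ℕ × ℕ) : ℂ :=
  coordCoeff 0 p.2.2 (coordCoeff 2 p.2.1 (coordCoeff 1 p.1 F)) 0

theorem continuous_coordMonomial (p : ℕ × ℕ × ℕ) : Continuous (coordMonomial p) := by
  unfold coordMonomial; fun_prop

theorem differentiable_coordMonomial (p : ℕ × ℕ × ℕ) : Differentiable ℂ (coordMonomial p) := by
  unfold coordMonomial; fun_prop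

theorem coordMonomial_mul (p : ℕ × ℕ × ℕ) (z w : Fin 3 → ℂ) :
    coordMonomial p (z * w) = coordMonomial p z * coordMonomial p w := by
  simp [coordMonomial, mul_pow]; ring

theorem norm_coordMonomial_le {z w : Fin 3 → ℂ} (h : ∀ i, ‖z i‖ ≤ ‖w i‖) (p : ℕ × ℕ × ℕ) :
    ‖coordMonomial p z‖ ≤ ‖coordMonomial p w‖ := by
  simp only [coordMonomial, norm_mul, norm_pow]
  gcongr <;> exact h _

/-- Each coefficient extraction removes the dependence on its own variable and preserves the
independence already gained, so after three of them the function is constant. -/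
theorem coordCoeff_eq_taylorCoeff (F : (Fin 3 → ℂ) → ℂ) (p : ℕ × ℕ × ℕ) (z : Fin 3 → ℂ) :
    coordCoeff 0 p.2.2 (coordCoeff 2 p.2.1 (coordCoeff 1 p.1 F)) z = taylorCoeff F p := by
  have h1 : ∀ z t, coordCoeff 1 p.1 F (Function.update z 1 t) = coordCoeff 1 p.1 F z :=
    coordCoeff_update_self _ _ _
  have h21 := coordCoeff_update_of_ne (show (2 : Fin 3) ≠ 1 by decide) p.2.1 h1
  have h22 := coordCoeff_update_self 2 p.2.1 (coordCoeff 1 p.1 F)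
  have h01 := coordCoeff_update_of_ne (show (0 : Fin 3) ≠ 1 by decide) p.2.2 h21
  have h02 := coordCoeff_update_of_ne (show (0 : Fin 3) ≠ 2 by decide) p.2.2 h22
  have h00 := coordCoeff_update_self 0 p.2.2 (coordCoeff 2 p.2.1 (coordCoeff 1 p.1 F))
  rw [taylorCoeff, ← h00 z 0, ← h01 _ 0, ← h02 _ 0]
  congr 1
  ext i
  fin_cases i <;> simp [Function.update]

section Reinhardt

variable {D : Set (Fin 3 → ℂ)} {F : (Fin 3 → ℂ) → ℂ}

/-- If the Taylor series of a holomorphic function on a complete Reinhardt domain is summable, it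
represents the function. -/
theorem hasSum_taylorCoeff (hD : IsOpen D) (hR : IsCompleteReinhardt D)
    (hF : DifferentiableOn ℂ F D) {w : Fin 3 → ℂ} (hw : w ∈ D)
    (hs : Summable fun p => taylorCoeff F p * coordMonomial p w) :
    HasSum (fun p => taylorCoeff F p * coordMonomial p w) (F w) := by
  have hF1 := fun b => differentiableOn_coordCoeff hD hR hF 1 b
  have hF2 := fun b c => differentiableOn_coordCoeff hD hR (hF1 b) 2 c
  have h2 : ∀ b, HasSum (fun q : ℕ × ℕ => taylorCoeff F (b, q) * coordMonomial (b, q) w)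
      (coordCoeff 1 b F w * w 1 ^ b) := by
    intro b
    obtain ⟨S, hS⟩ := hs.prod_factor b
    -- Given joint summability, the sum over a fibre may be computed iteratively, and each inner sum
    -- is a one-variable Taylor expansion.
    have h3 := hS.prod_fiberwise (g := fun c =>
      coordCoeff 2 c (coordCoeff 1 b F) w * w 2 ^ c * w 1 ^ b) (fun c => by
        have h4 := (hasSum_coordCoeff hD hR (hF2 b c) 0 hw).mul_right (w 2 ^ c * w 1 ^ b)
        rw [← mul_assoc] at h4
        refine h4.congr_fun fun a => ?_
        rw [← coordCoeff_eq_taylorCoeff F (b, c, a) w, coordMonomial]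
        ring)
    have h5 := (hasSum_coordCoeff hD hR (hF1 b) 2 hw).mul_right (w 1 ^ b)
    rwa [h3.unique h5] at hS
  obtain ⟨S, hS⟩ := hs
  have h6 := hS.prod_fiberwise h2
  rwa [h6.unique (hasSum_coordCoeff hD hR hF 1 hw)] at hS

/-- The conjugate monomial is homogeneous of degree minus the exponent under each rotation.
Averaging over one coordinate after another replaces `F` by its constant Taylor coefficient. -/
theorem integral_mul_conj_coordMonomial (hD : IsOpen D) (hR : IsCompleteReinhardt D)
    (hF : DifferentiableOn ℂ F D) (p : ℕ × ℕ × ℕ)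
    (hint : IntegrableOn (fun z => F z * conj (coordMonomial p z)) D) :
    ∫ z in D, F z * conj (coordMonomial p z) = taylorCoeff F p * monomialNormSq D p := by
  have hF1 := differentiableOn_coordCoeff hD hR hF 1 p.1
  have hF2 := differentiableOn_coordCoeff hD hR hF1 2 p.2.1
  have hexp : ∀ (k : ℕ) (θ : ℝ), conj (Complex.exp (θ * Complex.I)) ^ k =
      Complex.exp (-(k * θ * Complex.I)) := by
    intro k θ
    rw [← Complex.exp_conj, ← Complex.exp_nat_mul]
    congr 1
    simp
    ring
  obtain ⟨i1, e1⟩ := integral_mul_eq_integral_coordCoeff hD hR hF 1 p.1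
    (W := fun z => conj (coordMonomial p z)) (fun θ z => by
      simp only [coordMonomial, map_mul, map_pow, Function.update_self, mul_pow, ← hexp]
      simp
      ring) hint
  obtain ⟨i2, e2⟩ := integral_mul_eq_integral_coordCoeff hD hR hF1 2 p.2.1
    (W := fun z => z 1 ^ p.1 * conj (coordMonomial p z)) (fun θ z => by
      simp only [coordMonomial, map_mul, map_pow, Function.update_self, mul_pow, ← hexp]
      simp
      ring) i1
  obtain ⟨i3, e3⟩ := integral_mul_eq_integral_coordCoeff hD hR hF2 0 p.2.2
    (W := fun z => z 2 ^ p.2.1 * (z 1 ^ p.1 * conj (coordMonomial p z))) (fun θ z => by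
      simp only [coordMonomial, map_mul, map_pow, Function.update_self, mul_pow, ← hexp]
      simp
      ring) i2
  rw [e1, e2, e3]
  simp only [coordCoeff_eq_taylorCoeff]
  rw [integral_const_mul, monomialNormSq, ← integral_complex_ofReal]
  congr 2
  ext z
  rw [Complex.ofReal_pow, ← Complex.mul_conj', coordMonomial]
  ring

/-- Distinct monomials are orthogonal on a complete Reinhardt domain. -/
theorem integral_coordMonomial_mul_conj_of_ne (hD : IsOpen D) (hR : IsCompleteReinhardt D)
    {p p' : ℕ × ℕ × ℕ} (h : p ≠ p') :
    ∫ z in D, coordMonomial p' z * conj (coordMonomial p z) = 0 := by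
  obtain ⟨c, hc, hne⟩ : ∃ c : Fin 3 → ℂ, (∀ j, ‖c j‖ = 1) ∧
      coordMonomial p' c * conj (coordMonomial p c) = -1 := by
    -- The rotation by the angle `π / (k' - k)` flips the sign of the integrand, so the integral
    -- equals its own negative.
    have key : ∀ k k' : ℕ, k ≠ k' → ∃ u : ℂ, ‖u‖ = 1 ∧ u ^ k' * conj u ^ k = -1 := by
      intro k k' hk
      have hk' : (k' - k : ℂ) ≠ 0 := sub_ne_zero.2 (by exact_mod_cast hk.symm)
      refine ⟨Complex.exp ((Real.pi / (k' - k : ℝ) : ℝ) * Complex.I),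
        Complex.norm_exp_ofReal_mul_I _, ?_⟩
      rw [← Complex.exp_conj, ← Complex.exp_nat_mul, ← Complex.exp_nat_mul, ← Complex.exp_add,
        ← Complex.exp_pi_mul_I]
      congr 1
      simp
      field_simp
      ring
    have one : ∀ (i : Fin 3) (u : ℂ), ‖u‖ = 1 →
        ∀ j, ‖Function.update (1 : Fin 3 → ℂ) i u j‖ = 1 := by
      intro i u hu j
      rcases eq_or_ne j i with rfl | hj
      · simpa using hu
      · simp [hj]
    by_cases h1 : p.1 = p'.1
    · by_cases h2 : p.2.1 = p'.2.1
      · have h3 : p.2.2 ≠ p'.2.2 := fun h3 => h (Prod.ext h1 (Prod.ext h2 h3))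
        obtain ⟨u, hu, e⟩ := key _ _ h3
        exact ⟨Function.update 1 0 u, one 0 u hu, by simpa [coordMonomial] using e⟩
      · obtain ⟨u, hu, e⟩ := key _ _ h2
        exact ⟨Function.update 1 2 u, one 2 u hu, by simpa [coordMonomial] using e⟩
    · obtain ⟨u, hu, e⟩ := key _ _ h1
      exact ⟨Function.update 1 1 u, one 1 u hu, by simpa [coordMonomial] using e⟩
  have hmp := measurePreserving_mul_restrict hD hR hc
  have hcont : Continuous fun z => coordMonomial p' z * conj (coordMonomial p z) :=
    (continuous_coordMonomial p').mul (Complex.continuous_conj.comp (continuous_coordMonomial p))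
  have h1 : ∫ z in D, coordMonomial p' z * conj (coordMonomial p z) =
      -∫ z in D, coordMonomial p' z * conj (coordMonomial p z) := by
    conv_lhs => rw [← hmp.map_eq]
    rw [integral_map hmp.measurable.aemeasurable hcont.aestronglyMeasurable, ← integral_neg]
    congr 1
    ext z
    rw [coordMonomial_mul, coordMonomial_mul, map_mul]
    linear_combination (coordMonomial p' z * conj (coordMonomial p z)) * hne
  exact self_eq_neg.1 h1

end Reinhardt

/-! ### The Bergman space: monomial expansion, closedness and reproducing kernel -/

section Bergman

variable {D : Set (Fin 3 → ℂ)}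

theorem volume_lt_top_of_norm_le_one (hb : ∀ z ∈ D, ∀ i, ‖z i‖ ≤ 1) : volume D < ⊤ :=
  ((Metric.isBounded_closedBall (x := (0 : Fin 3 → ℂ)) (r := 1)).subset fun z hz => by
    rw [mem_closedBall_zero_iff]
    exact (pi_norm_le_iff_of_nonneg zero_le_one).2 (hb z hz)).measure_lt_top

theorem norm_coordMonomial_le_one {z : Fin 3 → ℂ} (hz : ∀ i, ‖z i‖ ≤ 1) (p : ℕ × ℕ × ℕ) :
    ‖coordMonomial p z‖ ≤ 1 := by
  simpa [coordMonomial] using norm_coordMonomial_le (w := 1) (by simpa using hz) p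

theorem memLp_coordMonomial (hD : IsOpen D) (hb : ∀ z ∈ D, ∀ i, ‖z i‖ ≤ 1) (p : ℕ × ℕ × ℕ) :
    MemLp (coordMonomial p) 2 (volume.restrict D) := by
  have : IsFiniteMeasure (volume.restrict D) :=
    ⟨by simpa using volume_lt_top_of_norm_le_one hb⟩
  refine MemLp.of_bound (continuous_coordMonomial p).aestronglyMeasurable 1 ?_
  filter_upwards [ae_restrict_mem hD.measurableSet] with z hz
    using norm_coordMonomial_le_one (hb z hz) p

/-- The normalized monomials, as elements of `L²(D)`. -/
noncomputable def monomialLp (hD : IsOpen D) (hb : ∀ z ∈ D, ∀ i, ‖z i‖ ≤ 1) (p : ℕ × ℕ × ℕ) :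
    Lp ℂ 2 (volume.restrict D) :=
  ((√(monomialNormSq D p))⁻¹ : ℂ) • (memLp_coordMonomial hD hb p).toLp

theorem monomialLp_mem (hD : IsOpen D) (hb : ∀ z ∈ D, ∀ i, ‖z i‖ ≤ 1) (p : ℕ × ℕ × ℕ) :
    monomialLp hD hb p ∈ bergmanSpace D :=
  Submodule.smul_mem _ _ ⟨coordMonomial p, (differentiable_coordMonomial p).differentiableOn,
    (memLp_coordMonomial hD hb p).coeFn_toLp⟩

/-- The values of the normalized monomials. -/
noncomputable def monomialValue (D : Set (Fin 3 → ℂ)) (p : ℕ × ℕ × ℕ) (z : Fin 3 → ℂ) : ℂ :=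
  (√(monomialNormSq D p) : ℂ)⁻¹ * coordMonomial p z

theorem inner_toLp_coordMonomial (hD : IsOpen D) (hb : ∀ z ∈ D, ∀ i, ‖z i‖ ≤ 1) (p : ℕ × ℕ × ℕ)
    {f : Lp ℂ 2 (volume.restrict D)} {g : (Fin 3 → ℂ) → ℂ} (hfg : f =ᵐ[volume.restrict D] g) :
    IntegrableOn (fun z => g z * conj (coordMonomial p z)) D ∧
      inner ℂ (memLp_coordMonomial hD hb p).toLp f = ∫ z in D, g z * conj (coordMonomial p z) := by
  have hae : (fun z => inner ℂ ((memLp_coordMonomial hD hb p).toLp _ z) (f z)) =ᵐ[volume.restrict D]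
      fun z => g z * conj (coordMonomial p z) := by
    filter_upwards [hfg, (memLp_coordMonomial hD hb p).coeFn_toLp] with z h1 h2
    rw [h1, h2, RCLike.inner_apply]
  exact ⟨(L2.integrable_inner _ f).congr hae, by rw [L2.inner_def, integral_congr_ae hae]⟩

theorem inner_monomialLp (hD : IsOpen D) (hR : IsCompleteReinhardt D)
    (hb : ∀ z ∈ D, ∀ i, ‖z i‖ ≤ 1) (hN : ∀ p, 0 < monomialNormSq D p) (p : ℕ × ℕ × ℕ)
    {f : Lp ℂ 2 (volume.restrict D)} {g : (Fin 3 → ℂ) → ℂ} (hg : DifferentiableOn ℂ g D)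
    (hfg : f =ᵐ[volume.restrict D] g) :
    inner ℂ (monomialLp hD hb p) f = taylorCoeff g p * √(monomialNormSq D p) := by
  obtain ⟨h1, h2⟩ := inner_toLp_coordMonomial hD hb p hfg
  rw [monomialLp, inner_smul_left, h2, integral_mul_conj_coordMonomial hD hR hg p h1]
  have hs : (√(monomialNormSq D p) : ℂ) ≠ 0 := by
    exact_mod_cast (Real.sqrt_pos.2 (hN p)).ne'
  have hs2 : (monomialNormSq D p : ℂ) = √(monomialNormSq D p) * √(monomialNormSq D p) := by
    rw [← Complex.ofReal_mul, Real.mul_self_sqrt (hN p).le]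
  rw [map_inv₀, Complex.conj_ofReal]
  rw [hs2]
  field_simp

theorem orthonormal_monomialLp (hD : IsOpen D) (hR : IsCompleteReinhardt D)
    (hb : ∀ z ∈ D, ∀ i, ‖z i‖ ≤ 1) (hN : ∀ p, 0 < monomialNormSq D p) :
    Orthonormal ℂ (monomialLp hD hb) := by
  rw [orthonormal_iff_ite]
  intro p p'
  obtain ⟨-, h2⟩ := inner_toLp_coordMonomial hD hb p (memLp_coordMonomial hD hb p').coeFn_toLp
  rw [monomialLp, monomialLp, inner_smul_left, inner_smul_right, h2]
  split_ifs with h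
  · subst h
    have h3 : ∫ z in D, coordMonomial p z * conj (coordMonomial p z) = monomialNormSq D p := by
      rw [monomialNormSq, ← integral_complex_ofReal]
      congr 1
      ext z
      rw [Complex.ofReal_pow, ← Complex.mul_conj']
    have hs : (√(monomialNormSq D p) : ℂ) ≠ 0 := by
      exact_mod_cast (Real.sqrt_pos.2 (hN p)).ne'
    have hs2 : (monomialNormSq D p : ℂ) = √(monomialNormSq D p) * √(monomialNormSq D p) := by
      rw [← Complex.ofReal_mul, Real.mul_self_sqrt (hN p).le]
    rw [h3, map_inv₀, Complex.conj_ofReal]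
    rw [hs2]
    field_simp
  · rw [integral_coordMonomial_mul_conj_of_ne hD hR h, mul_zero, mul_zero]

/-- Elements of the Bergman space are pointwise the sum of their monomial expansion. -/
theorem hasSum_monomialValue (hD : IsOpen D) (hR : IsCompleteReinhardt D)
    (hb : ∀ z ∈ D, ∀ i, ‖z i‖ ≤ 1) (hN : ∀ p, 0 < monomialNormSq D p)
    {f : Lp ℂ 2 (volume.restrict D)} {g : (Fin 3 → ℂ) → ℂ} (hg : DifferentiableOn ℂ g D)
    (hfg : f =ᵐ[volume.restrict D] g) {w : Fin 3 → ℂ} (hw : w ∈ D)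
    (hs : Summable fun p => ‖monomialValue D p w‖ ^ 2) :
    HasSum (fun p => monomialValue D p w * inner ℂ (monomialLp hD hb p) f) (g w) := by
  have heq : ∀ p, taylorCoeff g p * coordMonomial p w =
      monomialValue D p w * inner ℂ (monomialLp hD hb p) f := by
    intro p
    have hs : (√(monomialNormSq D p) : ℂ) ≠ 0 := by
      exact_mod_cast (Real.sqrt_pos.2 (hN p)).ne'
    rw [inner_monomialLp hD hR hb hN p hg hfg, monomialValue]
    field_simp
  have hsum : Summable fun p => taylorCoeff g p * coordMonomial p w := by
    simp only [heq]
    -- A product is bounded by the sum of squares; the squared coefficients are summable by Bessel's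
    -- inequality. This supplies the joint summability of the Taylor series.
    refine Summable.of_norm_bounded
      (hs.add ((orthonormal_monomialLp hD hR hb hN).inner_products_summable f)) fun p => ?_
    rw [norm_mul]
    nlinarith [sq_nonneg (‖monomialValue D p w‖ - ‖inner ℂ (monomialLp hD hb p) f‖),
      sq_nonneg ‖monomialValue D p w‖, sq_nonneg ‖inner ℂ (monomialLp hD hb p) f‖]
  simpa only [heq] using hasSum_taylorCoeff hD hR hg hw hsum

/-- Point evaluations are bounded on the Bergman space. -/
theorem norm_le_sqrt_mul_norm (hD : IsOpen D) (hR : IsCompleteReinhardt D)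
    (hb : ∀ z ∈ D, ∀ i, ‖z i‖ ≤ 1) (hN : ∀ p, 0 < monomialNormSq D p)
    {f : Lp ℂ 2 (volume.restrict D)} {g : (Fin 3 → ℂ) → ℂ} (hg : DifferentiableOn ℂ g D)
    (hfg : f =ᵐ[volume.restrict D] g) {w : Fin 3 → ℂ} (hw : w ∈ D)
    (hs : Summable fun p => ‖monomialValue D p w‖ ^ 2) :
    ‖g w‖ ≤ √(∑' p, ‖monomialValue D p w‖ ^ 2) * ‖f‖ := by
  have h1 := hasSum_monomialValue hD hR hb hN hg hfg hw hs
  have hortho := orthonormal_monomialLp hD hR hb hN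
  -- Cauchy–Schwarz for the monomial expansion; Bessel's inequality then bounds the coefficient
  -- factor by `‖f‖`.
  have h2 := Real.summable_and_inner_le_Lp_mul_Lq_tsum_of_nonneg (p := 2) (q := 2)
    Real.HolderConjugate.two_two (fun p => norm_nonneg (monomialValue D p w))
    (fun p => norm_nonneg (inner ℂ (monomialLp hD hb p) f))
    (by simpa only [Real.rpow_two] using hs)
    (by simpa only [Real.rpow_two] using hortho.inner_products_summable f)
  simp only [Real.rpow_two, ← Real.sqrt_eq_rpow, ← norm_mul] at h2
  rw [← h1.tsum_eq]
  refine (norm_tsum_le_tsum_norm h2.1).trans (h2.2.trans ?_)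
  gcongr
  rw [← Real.sqrt_sq (norm_nonneg f)]
  exact Real.sqrt_le_sqrt (hortho.tsum_inner_products_le f)

-- Raising every modulus by a small `ε` gives a point of `D` that dominates a neighbourhood of `x`;
-- its evaluation constant therefore works on the whole neighbourhood.
open Filter Topology in
theorem IsCompleteReinhardt.exists_forall_mem_nhds_norm_le (hD : IsOpen D)
    (hR : IsCompleteReinhardt D) {x : Fin 3 → ℂ} (hx : x ∈ D) :
    ∃ y ∈ D, ∀ᶠ w in 𝓝 x, ∀ i, ‖w i‖ ≤ ‖y i‖ := by
  have hcont : Continuous fun ε : ℝ => (fun i => ((‖x i‖ + ε : ℝ) : ℂ) : Fin 3 → ℂ) := by fun_prop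
  have hmem : (fun i => ((‖x i‖ + 0 : ℝ) : ℂ) : Fin 3 → ℂ) ∈ D := hR x hx _ fun i => by simp
  obtain ⟨ε, hε0, hε⟩ : ∃ ε > 0, (fun i => ((‖x i‖ + ε : ℝ) : ℂ) : Fin 3 → ℂ) ∈ D := by
    have h := (hD.preimage hcont).mem_nhds hmem
    obtain ⟨δ, hδ, hball⟩ := Metric.mem_nhds_iff.1 h
    refine ⟨δ / 2, by positivity, hball ?_⟩
    rw [Metric.mem_ball, Real.dist_eq, sub_zero, abs_of_pos (by positivity)]
    linarith
  refine ⟨_, hε, ?_⟩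
  rw [eventually_all]
  intro i
  have h : ContinuousAt (fun w : Fin 3 → ℂ => ‖w i‖) x :=
    (continuous_norm.comp (continuous_apply i)).continuousAt
  filter_upwards [h.eventually (gt_mem_nhds (show ‖x i‖ < ‖x i‖ + ε by linarith))] with w hw
  rw [Complex.norm_real, Real.norm_of_nonneg (by positivity)]
  exact hw.le

-- The evaluation constants are locally bounded, so an `L²` limit of holomorphic functions is also a
-- locally uniform one, hence holomorphic.
open Filter Topology in
theorem isClosed_bergmanSpace (hD : IsOpen D) (hR : IsCompleteReinhardt D)
    (hb : ∀ z ∈ D, ∀ i, ‖z i‖ ≤ 1) (hN : ∀ p, 0 < monomialNormSq D p)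
    (hs : ∀ w ∈ D, Summable fun p => ‖monomialValue D p w‖ ^ 2) :
    IsClosed (bergmanSpace D : Set (Lp ℂ 2 (volume.restrict D))) := by
  refine isClosed_of_closure_subset fun f hf => ?_
  obtain ⟨u, hu, hlim⟩ := mem_closure_iff_seq_limit.1 hf
  choose g hg hug using hu
  have hdiff : ∀ m n, ∀ w ∈ D,
      ‖g m w - g n w‖ ≤ √(∑' p, ‖monomialValue D p w‖ ^ 2) * ‖u m - u n‖ := by
    intro m n w hw
    exact norm_le_sqrt_mul_norm hD hR hb hN (f := u m - u n) ((hg m).sub (hg n))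
      ((Lp.coeFn_sub _ _).trans ((hug m).sub (hug n))) hw (hs w hw)
  have hcauchy := Metric.cauchySeq_iff.1 hlim.cauchySeq
  have hunif : ∀ x ∈ D, ∃ t ∈ 𝓝 x, UniformCauchySeqOn g atTop t := by
    intro x hx
    obtain ⟨y, hy, hev⟩ := hR.exists_forall_mem_nhds_norm_le hD hx
    refine ⟨_, hev, Metric.uniformCauchySeqOn_iff.2 fun ε hε => ?_⟩
    set S := √(∑' p, ‖monomialValue D p y‖ ^ 2)
    have hS : 0 ≤ S := Real.sqrt_nonneg _
    -- The `+ 1` covers `S = 0` and makes the final inequality strict.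
    obtain ⟨N, hN'⟩ := hcauchy (ε / (S + 1)) (by positivity)
    refine ⟨N, fun m hm n hn w hw => ?_⟩
    have hwD : w ∈ D := hR y hy w hw
    have hle : √(∑' p, ‖monomialValue D p w‖ ^ 2) ≤ S := by
      refine Real.sqrt_le_sqrt ((hs w hwD).tsum_le_tsum (fun p => ?_) (hs y hy))
      simp only [monomialValue, norm_mul]
      gcongr
      exact norm_coordMonomial_le hw p
    have h3 := hN' m hm n hn
    rw [dist_eq_norm] at h3 ⊢
    calc ‖g m w - g n w‖ ≤ √(∑' p, ‖monomialValue D p w‖ ^ 2) * ‖u m - u n‖ := hdiff m n w hwD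
      _ ≤ S * (ε / (S + 1)) := by gcongr
      _ < (S + 1) * (ε / (S + 1)) := by gcongr; linarith
      _ = ε := by field_simp
  have hex : ∀ w ∈ D, ∃ L, Tendsto (fun n => g n w) atTop (𝓝 L) := by
    intro w hw
    obtain ⟨t, ht, hc⟩ := hunif w hw
    exact cauchySeq_tendsto_of_complete (hc.cauchySeq (mem_of_mem_nhds ht))
  choose! G hG using hex
  have hGd : DifferentiableOn ℂ G D := by
    refine differentiableOn_of_locally_tendstoUniformlyOn (f := g) (l := atTop) hD hg fun x hx => ?_
    obtain ⟨t, ht, hc⟩ := hunif x hx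
    exact ⟨t ∩ D, inter_mem ht (hD.mem_nhds hx),
      (hc.mono Set.inter_subset_left).tendstoUniformlyOn_of_tendsto fun w hw => hG w hw.2⟩
  refine ⟨G, hGd, ?_⟩
  -- An almost everywhere convergent subsequence identifies the pointwise limit `G` with `f`.
  obtain ⟨ns, hns, hae⟩ := (tendstoInMeasure_of_tendsto_Lp hlim).exists_seq_tendsto_ae
  filter_upwards [hae, ae_all_iff.2 hug, ae_restrict_mem hD.measurableSet] with w h1 h2 h3
  simp only [h2] at h1
  exact tendsto_nhds_unique h1 ((hG w h3).comp hns.tendsto_atTop)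

/-- The Bergman kernel of a bounded complete Reinhardt domain is the sum of the monomial series. -/
theorem isBergmanKernel_of_hasSum (hD : IsOpen D) (hR : IsCompleteReinhardt D)
    (hb : ∀ z ∈ D, ∀ i, ‖z i‖ ≤ 1) (hN : ∀ p, 0 < monomialNormSq D p)
    {K : (Fin 3 → ℂ) → (Fin 3 → ℂ) → ℂ}
    (hK : ∀ z ∈ D, ∀ w ∈ D, HasSum (fun p => coordMonomial p z * conj (coordMonomial p w) /
      monomialNormSq D p) (K z w)) : IsBergmanKernel D K := by
  have hprod : ∀ z w p, monomialValue D p z * conj (monomialValue D p w) =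
      coordMonomial p z * conj (coordMonomial p w) / monomialNormSq D p := by
    intro z w p
    have hs : (√(monomialNormSq D p) : ℂ) ≠ 0 := by
      exact_mod_cast (Real.sqrt_pos.2 (hN p)).ne'
    have hs2 : (monomialNormSq D p : ℂ) = √(monomialNormSq D p) * √(monomialNormSq D p) := by
      rw [← Complex.ofReal_mul, Real.mul_self_sqrt (hN p).le]
    rw [monomialValue, monomialValue, map_mul, map_inv₀, Complex.conj_ofReal]
    rw [hs2]
    field_simp
  -- This is the kernel series on the diagonal.
  have hs : ∀ w ∈ D, Summable fun p => ‖monomialValue D p w‖ ^ 2 := by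
    intro w hw
    refine (hK w hw w hw).summable.norm.congr fun p => ?_
    rw [← hprod, norm_mul, RCLike.norm_conj, sq]
  have : CompleteSpace (bergmanSpace D) :=
    (isClosed_bergmanSpace hD hR hb hN hs).completeSpace_coe
  let v : ℕ × ℕ × ℕ → bergmanSpace D := fun p => ⟨monomialLp hD hb p, monomialLp_mem hD hb p⟩
  have hv : Orthonormal ℂ v :=
    (orthonormal_monomialLp hD hR hb hN).codRestrict (bergmanSpace D) (monomialLp_mem hD hb)
  have hexp : ∀ (f : bergmanSpace D), ∀ w ∈ D,
      HasSum (fun p => monomialValue D p w * inner ℂ (v p) f) (holRep f w) := fun f w hw =>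
    hasSum_monomialValue hD hR hb hN (Classical.choose_spec f.2).1 (Classical.choose_spec f.2).2 hw
      (hs w hw)
  -- Orthogonality to all monomials kills every term of the pointwise expansion.
  have hbot : (Submodule.span ℂ (Set.range v))ᗮ = ⊥ := by
    rw [Submodule.eq_bot_iff]
    intro f hf
    have h0 : ∀ p, inner ℂ (v p) f = 0 := fun p =>
      Submodule.mem_orthogonal _ _ |>.1 hf _ (Submodule.subset_span ⟨p, rfl⟩)
    have hz : ∀ w ∈ D, holRep f w = 0 := by
      intro w hw
      have := hexp f w hw
      simp only [h0, mul_zero] at this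
      exact this.unique hasSum_zero
    refine Subtype.ext ((Lp.eq_zero_iff_ae_eq_zero).2 ?_)
    filter_upwards [(Classical.choose_spec f.2).2, ae_restrict_mem hD.measurableSet] with w h1 h2
    rw [h1]
    exact hz w h2
  refine ⟨?_, fun φ z hz w hw => ?_⟩
  · obtain ⟨e⟩ : Nonempty (ℕ ≃ ℕ × ℕ × ℕ) :=
      ⟨(Nat.pairEquiv.symm).trans ((Equiv.refl ℕ).prodCongr Nat.pairEquiv.symm)⟩
    refine ⟨HilbertBasis.mkOfOrthogonalEqBot (hv.comp e e.injective) ?_⟩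
    rwa [e.surjective.range_comp]
  · let b := HilbertBasis.mkOfOrthogonalEqBot hv hbot
    have hbv : ⇑b = v := HilbertBasis.coe_mkOfOrthogonalEqBot hv hbot
    have hmem : ∀ w ∈ D, Memℓp (fun p => conj (monomialValue D p w)) 2 := fun w hw => by
      rw [memℓp_gen_iff (by norm_num)]
      simpa using hs w hw
    -- The reproducing element at `w`: its monomial coefficients are the conjugated values at `w`,
    -- which are square summable.
    have hker : ∀ w ∈ D, ∃ k : bergmanSpace D, (∀ p, inner ℂ k (v p) = monomialValue D p w) ∧
        ∀ f, inner ℂ k f = holRep f w := by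
      intro w hw
      obtain ⟨c, hc⟩ : ∃ c : lp (fun _ : ℕ × ℕ × ℕ => ℂ) 2,
          ∀ p, c p = conj (monomialValue D p w) := ⟨⟨_, hmem w hw⟩, fun p => rfl⟩
      have h1 : ∀ p, inner ℂ (b.repr.symm c) (v p) = monomialValue D p w := by
        intro p
        rw [← inner_conj_symm (𝕜 := ℂ) (b.repr.symm c) (v p), ← hbv, ← b.repr_apply_apply, LinearIsometryEquiv.apply_symm_apply,
          hc, Complex.conj_conj]
      refine ⟨b.repr.symm c, h1, fun f => ?_⟩
      have h2 := b.hasSum_inner_mul_inner (b.repr.symm c) f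
      simp only [hbv, h1] at h2
      exact h2.unique (hexp f w hw)
    obtain ⟨k, hk1, hk2⟩ := hker z hz
    obtain ⟨l, hl1, hl2⟩ := hker w hw
    have hinner : inner ℂ k l = K z w := by
      have h3 := b.hasSum_inner_mul_inner k l
      refine h3.unique ((hK z hz w hw).congr_fun fun p => ?_)
      rw [hbv, hk1, ← inner_conj_symm, hl1, hprod]
    -- Parseval for the arbitrary basis `φ`; the two factors are the values `φⱼ(z)` and `conj
    -- (φⱼ(w))`.
    have h4 := φ.hasSum_inner_mul_inner k l
    rw [hinner] at h4
    refine h4.congr_fun fun j => ?_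
    rw [hk2, ← inner_conj_symm (φ j) l, hl2]

end Bergman

/-! ### Norms of the monomials -/

/-- A Beta integral, by induction on `a`. The product form, rather than Gamma functions, matches the
coefficients of the binomial series used later. -/
theorem integral_pow_mul_one_sub_sq_rpow (a : ℕ) {s : ℝ} (hs : 0 ≤ s) :
    ∫ t in (0 : ℝ)..1, t ^ (2 * a + 1) * (1 - t ^ 2) ^ s =
      a.factorial / (2 * ∏ j ∈ Finset.range (a + 1), (s + 1 + j)) := by
  have hd : ∀ (s : ℝ), 0 ≤ s → ∀ t : ℝ, HasDerivAt (fun t : ℝ => (1 - t ^ 2) ^ (s + 1))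
      (-(2 * (s + 1)) * (t * (1 - t ^ 2) ^ s)) t := by
    intro s hs t
    have h := ((hasDerivAt_pow 2 t).const_sub 1).rpow_const (p := s + 1) (Or.inr (by linarith))
    convert h using 1
    simp
    ring
  have hc : ∀ (s : ℝ), 0 ≤ s → Continuous fun t : ℝ => (1 - t ^ 2) ^ s := fun s hs =>
    (by fun_prop : Continuous fun t : ℝ => 1 - t ^ 2).rpow_const fun _ => Or.inr hs
  induction a generalizing s with
  | zero =>
    have h := intervalIntegral.integral_eq_sub_of_hasDerivAt (a := 0) (b := 1)
      (fun t _ => hd s hs t)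
      ((continuous_const.mul (continuous_id.mul (hc s hs))).intervalIntegrable _ _)
    rw [intervalIntegral.integral_const_mul] at h
    have h0 : (0 : ℝ) ^ (s + 1) = 0 := Real.zero_rpow (by linarith)
    norm_num [h0] at h
    simp only [mul_zero, zero_add, pow_one, Nat.factorial_zero, Nat.cast_one,
      Finset.prod_range_one, Nat.cast_zero, add_zero]
    field_simp
    linarith
  | succ a ih =>
    -- Integration by parts: this primitive vanishes at 0 and 1, which trades a power of `t ^ 2` for
    -- raising `s` by one; hence the induction generalizes over `s`.
    have hprod : ∀ t : ℝ, HasDerivAt (fun t : ℝ => t ^ (2 * a + 2) * (1 - t ^ 2) ^ (s + 1))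
        ((2 * a + 2) * (t ^ (2 * a + 1) * (1 - t ^ 2) ^ (s + 1)) -
          2 * (s + 1) * (t ^ (2 * (a + 1) + 1) * (1 - t ^ 2) ^ s)) t := by
      intro t
      have h := (hasDerivAt_pow (2 * a + 2) t).mul (hd s hs t)
      refine h.congr_deriv ?_
      simp
      ring
    have c1 : Continuous fun t : ℝ => (2 * a + 2) * (t ^ (2 * a + 1) * (1 - t ^ 2) ^ (s + 1)) :=
      continuous_const.mul ((continuous_pow _).mul (hc _ (by linarith)))
    have c2 : Continuous fun t : ℝ => 2 * (s + 1) * (t ^ (2 * (a + 1) + 1) * (1 - t ^ 2) ^ s) :=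
      continuous_const.mul ((continuous_pow _).mul (hc _ hs))
    have h := intervalIntegral.integral_eq_sub_of_hasDerivAt (a := 0) (b := 1)
      (fun t _ => hprod t) ((c1.sub c2).intervalIntegrable _ _)
    rw [intervalIntegral.integral_sub (c1.intervalIntegrable _ _) (c2.intervalIntegrable _ _),
      intervalIntegral.integral_const_mul, intervalIntegral.integral_const_mul,
      ih (by linarith : 0 ≤ s + 1)] at h
    have h0 : (0 : ℝ) ^ (s + 1) = 0 := Real.zero_rpow (by linarith)
    norm_num [h0] at h
    have hP : ∏ j ∈ Finset.range (a + 1 + 1), (s + 1 + (j : ℝ)) =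
        (∏ j ∈ Finset.range (a + 1), (s + 1 + 1 + (j : ℝ))) * (s + 1) := by
      rw [Finset.prod_range_succ']
      congr 1
      · refine Finset.prod_congr rfl fun j _ => ?_
        push_cast; ring
      · simp
    have hP0 : 0 < ∏ j ∈ Finset.range (a + 1), (s + 1 + 1 + (j : ℝ)) :=
      Finset.prod_pos fun j _ => by positivity
    rw [hP, Nat.factorial_succ]
    push_cast
    field_simp
    field_simp at h
    linarith

theorem integral_complex_radial (f : ℝ → ℝ) :
    ∫ x : ℂ, f ‖x‖ = 2 * Real.pi * ∫ y in Set.Ioi (0 : ℝ), y * f y := by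
  rw [integral_fun_norm_addHaar]
  simp [Complex.finrank_real_complex, Measure.real, Complex.volume_ball]
  ring

theorem integral_disc_pow {q T : ℝ} (hq : 0 < q) (hT : 0 < T) (b : ℕ) :
    ∫ x : ℂ, (if ‖x‖ ^ q < T then ‖x‖ ^ (2 * b) else 0) =
      Real.pi * T ^ (2 * (b + 1) / q) / (b + 1) := by
  rw [integral_complex_radial fun y => if y ^ q < T then y ^ (2 * b) else 0]
  set R := T ^ q⁻¹ with hR
  have hR0 : 0 < R := Real.rpow_pos_of_pos hT _
  have h1 : ∫ y in Set.Ioi (0 : ℝ), y * (if y ^ q < T then y ^ (2 * b) else 0) =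
      ∫ y in (0 : ℝ)..R, y ^ (2 * b + 1) := by
    rw [intervalIntegral.integral_of_le hR0.le, integral_Ioc_eq_integral_Ioo,
      ← integral_indicator measurableSet_Ioi, ← integral_indicator measurableSet_Ioo]
    congr 1
    ext y
    by_cases hy : 0 < y
    · have : y ^ q < T ↔ y < R := by
        rw [hR, Real.lt_rpow_inv_iff_of_pos hy.le hT.le hq]
      by_cases hyR : y < R
      · simp [Set.indicator, hy, this, hyR]; ring
      · simp [Set.indicator, hy, this, hyR]
    · simp [Set.indicator, hy]
  have h2 : R ^ (2 * b + 1 + 1) = T ^ (2 * (b + 1) / q) := by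
    rw [hR, ← Real.rpow_natCast, ← Real.rpow_mul hT.le]
    congr 1
    push_cast
    field_simp
    ring
  rw [h1, integral_pow, h2]
  simp
  field_simp
  ring

theorem measurePreserving_coords :
    MeasurePreserving (fun z : Fin 3 → ℂ => (z 0, (z 1, z 2))) volume volume ∧
      MeasurableEmbedding (fun z : Fin 3 → ℂ => (z 0, (z 1, z 2))) := by
  have h1 := volume_preserving_piFinSuccAbove (fun _ : Fin 3 => ℂ) 0
  have h2 := (MeasurePreserving.id (volume : Measure ℂ)).prod
    (volume_preserving_finTwoArrow ℂ)
  constructor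
  · exact h2.comp h1
  · exact ((MeasurableEquiv.refl ℂ).prodCongr
      (MeasurableEquiv.finTwoArrow)).measurableEmbedding.comp
        (MeasurableEquiv.piFinSuccAbove (fun _ : Fin 3 => ℂ) 0).measurableEmbedding

section Ellipsoid

variable {q r : ℝ}

theorem isOpen_ellipsoidIntersection (hq : 0 < q) (hr : 0 < r) :
    IsOpen (ellipsoidIntersection q r) := by
  have h : ∀ (s : ℝ), 0 < s → ∀ i : Fin 3, Continuous fun z : Fin 3 → ℂ => ‖z 0‖ ^ 2 + ‖z i‖ ^ s :=
    fun s hs i => ((continuous_norm.comp (continuous_apply 0)).pow 2).add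
      ((continuous_norm.comp (continuous_apply i)).rpow_const fun _ => Or.inr hs.le)
  exact (isOpen_lt (h q hq 1) continuous_const).inter (isOpen_lt (h r hr 2) continuous_const)

theorem isCompleteReinhardt_ellipsoidIntersection (hq : 0 < q) (hr : 0 < r) :
    IsCompleteReinhardt (ellipsoidIntersection q r) := by
  rintro z ⟨h1, h2⟩ w hw
  constructor
  · refine lt_of_le_of_lt ?_ h1
    gcongr <;> exact hw _
  · refine lt_of_le_of_lt ?_ h2
    gcongr <;> exact hw _

theorem norm_le_one_of_mem_ellipsoidIntersection (hq : 0 < q) (hr : 0 < r) {z : Fin 3 → ℂ}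
    (hz : z ∈ ellipsoidIntersection q r) (i : Fin 3) : ‖z i‖ ≤ 1 := by
  obtain ⟨h1, h2⟩ := hz
  have e1 := Real.rpow_nonneg (norm_nonneg (z 1)) q
  have e2 := Real.rpow_nonneg (norm_nonneg (z 2)) r
  fin_cases i
  · refine (sq_le_one_iff₀ (norm_nonneg (z 0))).1 (by linarith)
  · refine not_lt.1 fun h => ?_
    have := Real.one_lt_rpow (x := ‖z 1‖) h hq
    nlinarith [sq_nonneg ‖z 0‖]
  · refine not_lt.1 fun h => ?_
    have := Real.one_lt_rpow (x := ‖z 2‖) h hr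
    nlinarith [sq_nonneg ‖z 0‖]

/-- For fixed `z 0` the slice is a product of discs of radii `(1 - ‖z 0‖ ^ 2) ^ (1 / q)` and `(1 -
‖z 0‖ ^ 2) ^ (1 / r)`. Their moments combine into the single power `s` of `1 - ‖z 0‖ ^ 2`, and polar
coordinates in `z 0` leave the Beta integral. -/
theorem monomialNormSq_ellipsoidIntersection (hq : 0 < q) (hr : 0 < r) (b c a : ℕ) :
    monomialNormSq (ellipsoidIntersection q r) (b, c, a) =
      Real.pi ^ 3 * a.factorial / ((b + 1) * (c + 1) *
        ∏ j ∈ Finset.range (a + 1), (2 * (b + 1) / q + 2 * (c + 1) / r + 1 + j)) := by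
  classical
  have hD := isOpen_ellipsoidIntersection hq hr
  set s : ℝ := 2 * (b + 1) / q + 2 * (c + 1) / r with hs
  have hs0 : 0 ≤ s := by positivity
  set A : ℂ → ℂ → ℝ := fun x y => if ‖y‖ ^ q < 1 - ‖x‖ ^ 2 then ‖y‖ ^ (2 * b) else 0
  set B : ℂ → ℂ → ℝ := fun x u => if ‖u‖ ^ r < 1 - ‖x‖ ^ 2 then ‖u‖ ^ (2 * c) else 0
  set H : ℂ × ℂ × ℂ → ℝ := fun p => ‖p.1‖ ^ (2 * a) * (A p.1 p.2.1 * B p.1 p.2.2) with hH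
  obtain ⟨hmp, hemb⟩ := measurePreserving_coords
  have hind : (ellipsoidIntersection q r).indicator
      (fun z => ‖coordMonomial (b, c, a) z‖ ^ 2) = H ∘ fun z => (z 0, (z 1, z 2)) := by
    ext z
    have e1 : ‖z 0‖ ^ 2 + ‖z 1‖ ^ q < 1 ↔ ‖z 1‖ ^ q < 1 - ‖z 0‖ ^ 2 := by
      constructor <;> intro h <;> linarith
    have e2 : ‖z 0‖ ^ 2 + ‖z 2‖ ^ r < 1 ↔ ‖z 2‖ ^ r < 1 - ‖z 0‖ ^ 2 := by
      constructor <;> intro h <;> linarith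
    have hmem : z ∈ ellipsoidIntersection q r ↔
        ‖z 1‖ ^ q < 1 - ‖z 0‖ ^ 2 ∧ ‖z 2‖ ^ r < 1 - ‖z 0‖ ^ 2 := and_congr e1 e2
    simp only [Set.indicator, hmem, Function.comp, hH, A, B, coordMonomial]
    by_cases h1 : ‖z 1‖ ^ q < 1 - ‖z 0‖ ^ 2
    · by_cases h2 : ‖z 2‖ ^ r < 1 - ‖z 0‖ ^ 2
      · simp [h1, h2]; ring
      · simp [h1, h2]
    · simp [h1]
  have hint : Integrable H := by
    rw [← hmp.integrable_comp_emb hemb, ← hind, integrable_indicator_iff hD.measurableSet]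
    exact (memLp_two_iff_integrable_sq_norm
      (continuous_coordMonomial _).aestronglyMeasurable).1
      (memLp_coordMonomial hD (fun z hz => norm_le_one_of_mem_ellipsoidIntersection hq hr hz) _)
  have h1 : monomialNormSq (ellipsoidIntersection q r) (b, c, a) = ∫ p, H p := by
    rw [monomialNormSq, ← integral_indicator hD.measurableSet, hind]
    exact hmp.integral_comp hemb H
  have h2 : ∀ x : ℂ, ∫ p : ℂ × ℂ, H (x, p) = (fun t : ℝ => if t < 1 then
      Real.pi ^ 2 / ((b + 1) * (c + 1)) * (t ^ (2 * a) * (1 - t ^ 2) ^ s) else 0) ‖x‖ := by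
    intro x
    have h3 : ∫ p : ℂ × ℂ, H (x, p) = ‖x‖ ^ (2 * a) * ((∫ y, A x y) * ∫ u, B x u) := by
      simp only [hH]
      rw [integral_const_mul]
      congr 1
      exact integral_prod_mul (A x) (B x)
    rw [h3]
    simp only [A, B]
    split_ifs with hx
    · have hT : 0 < 1 - ‖x‖ ^ 2 := by nlinarith [norm_nonneg x]
      rw [integral_disc_pow hq hT, integral_disc_pow hr hT, hs, Real.rpow_add hT]
      field_simp
    -- For `‖x‖ ≥ 1` the slice is empty.
    · have hA : ∀ y : ℂ, ¬ ‖y‖ ^ q < 1 - ‖x‖ ^ 2 := fun y hy => by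
        have := Real.rpow_nonneg (norm_nonneg y) q
        nlinarith
      simp [hA]
  have h4 : ∫ p, H p = 2 * Real.pi * (Real.pi ^ 2 / ((b + 1) * (c + 1)) *
      ∫ t in (0 : ℝ)..1, t ^ (2 * a + 1) * (1 - t ^ 2) ^ s) := by
    have h5 : ∫ p, H p = ∫ x, ∫ p, H (x, p) := integral_prod H hint
    rw [h5]
    simp only [h2]
    rw [integral_complex_radial fun t : ℝ => if t < 1 then
      Real.pi ^ 2 / ((b + 1) * (c + 1)) * (t ^ (2 * a) * (1 - t ^ 2) ^ s) else 0]
    congr 1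
    rw [← intervalIntegral.integral_const_mul, intervalIntegral.integral_of_le zero_le_one,
      integral_Ioc_eq_integral_Ioo, ← integral_indicator measurableSet_Ioi,
      ← integral_indicator measurableSet_Ioo]
    congr 1
    ext t
    by_cases ht : 0 < t
    · by_cases ht1 : t < 1
      · simp [Set.indicator, ht, ht1]; ring
      · simp [Set.indicator, ht, ht1]
    · simp [Set.indicator, ht]
  have hP0 : 0 < ∏ j ∈ Finset.range (a + 1), (s + 1 + (j : ℝ)) :=
    Finset.prod_pos fun j _ => by positivity
  rw [h1, h4, integral_pow_mul_one_sub_sq_rpow a hs0]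
  field_simp

theorem monomialNormSq_ellipsoidIntersection_pos (hq : 0 < q) (hr : 0 < r) (p : ℕ × ℕ × ℕ) :
    0 < monomialNormSq (ellipsoidIntersection q r) p := by
  obtain ⟨b, c, a⟩ := p
  rw [monomialNormSq_ellipsoidIntersection hq hr]
  have := Finset.prod_pos (s := Finset.range (a + 1))
    (f := fun j : ℕ => 2 * (b + 1 : ℝ) / q + 2 * (c + 1) / r + 1 + j) fun j _ => by positivity
  have := a.factorial_pos
  have := Real.pi_pos
  positivity

end Ellipsoid

/-! ### Summation of the monomial series -/

theorem hasSum_prod_div_factorial_mul_pow (x : ℂ) {u : ℂ} (hu : ‖u‖ < 1) :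
    HasSum (fun n : ℕ => (∏ j ∈ Finset.range n, (x + j)) / n.factorial * u ^ n)
      (1 / (1 - u) ^ x) := by
  have h := (Complex.one_div_one_sub_cpow_hasFPowerSeriesOnBall_zero x).hasSum (y := u)
    (by simpa [← ofReal_norm] using hu)
  simp only [zero_add] at h
  refine h.congr_fun fun n => ?_
  have hp : ∀ n : ℕ, (ascPochhammer ℕ n).smeval x = ∏ j ∈ Finset.range n, (x + j) := by
    intro n
    rw [Polynomial.ascPochhammer_smeval_eq_eval]
    induction n with
    | zero => simp
    | succ n ih => rw [ascPochhammer_succ_eval, ih, Finset.prod_range_succ]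
  have h1 := Ring.factorial_nsmul_multichoose_eq_ascPochhammer x n
  rw [hp, Ring.multichoose_eq, nsmul_eq_mul] at h1
  have hn : (n.factorial : ℂ) ≠ 0 := by exact_mod_cast n.factorial_ne_zero
  rw [← h1]
  simp
  field_simp

theorem hasSum_succ_mul_pow {x : ℂ} (hx : ‖x‖ < 1) :
    HasSum (fun n : ℕ => (n + 1 : ℂ) * x ^ n) (1 / (1 - x) ^ 2) := by
  simpa using hasSum_choose_mul_geometric_of_norm_lt_one 1 hx

theorem one_sub_ne_zero_of_norm_lt_one {x : ℂ} (hx : ‖x‖ < 1) : 1 - x ≠ 0 := by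
  intro h
  rw [← sub_eq_zero.1 h, norm_one] at hx
  exact lt_irrefl _ hx

/-- Uses `(n + 1)² = 2 * choose (n + 2) 2 - (n + 1)`. -/
theorem hasSum_succ_sq_mul_pow {x : ℂ} (hx : ‖x‖ < 1) :
    HasSum (fun n : ℕ => (n + 1 : ℂ) ^ 2 * x ^ n) ((1 + x) / (1 - x) ^ 3) := by
  have h := ((hasSum_choose_mul_geometric_of_norm_lt_one 2 hx).mul_left 2).sub
    (hasSum_succ_mul_pow hx)
  have hx1 := one_sub_ne_zero_of_norm_lt_one hx
  have he : 2 * (1 / (1 - x) ^ (2 + 1)) - 1 / (1 - x) ^ 2 = (1 + x) / (1 - x) ^ 3 := by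
    field_simp
    ring
  rw [he] at h
  refine h.congr_fun fun n => ?_
  have h2 : (((n + 2).choose 2 : ℕ) : ℂ) = (n + 2) * (n + 1) / 2 := by
    rw [Nat.cast_choose_two]
    push_cast
    ring
  rw [h2]
  ring

/-- The norms are cast to `ℂ` so that the closed forms proved for complex arguments also serve to
show absolute convergence. -/
theorem summable_of_iterated_hasSum_norm {f : ℕ × ℕ × ℕ → ℂ} {F : ℕ → ℕ → ℂ} {G : ℕ → ℂ} {S : ℂ}
    (h3 : ∀ b c, HasSum (fun a => (‖f (b, c, a)‖ : ℂ)) (F b c)) (h2 : ∀ b, HasSum (F b) (G b))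
    (h1 : HasSum G S) : Summable f := by
  refine Summable.of_norm ?_
  have e3 : ∀ b c, Summable fun a => ‖f (b, c, a)‖ := fun b c =>
    Complex.summable_ofReal.1 (h3 b c).summable
  have f3 : ∀ b c, ((∑' a, ‖f (b, c, a)‖ : ℝ) : ℂ) = F b c := fun b c => by
    rw [Complex.ofReal_tsum, (h3 b c).tsum_eq]
  have e2 : ∀ b, Summable fun c => ∑' a, ‖f (b, c, a)‖ := fun b =>
    Complex.summable_ofReal.1 (by simpa only [f3] using (h2 b).summable)
  have s2 : ∀ b, Summable fun p : ℕ × ℕ => ‖f (b, p)‖ := fun b =>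
    (summable_prod_of_nonneg fun p => norm_nonneg _).2 ⟨e3 b, e2 b⟩
  have f2 : ∀ b, ((∑' p : ℕ × ℕ, ‖f (b, p)‖ : ℝ) : ℂ) = G b := fun b => by
    rw [(s2 b).tsum_prod, Complex.ofReal_tsum]
    simp only [f3]
    exact (h2 b).tsum_eq
  refine (summable_prod_of_nonneg fun p => norm_nonneg _).2 ⟨s2, ?_⟩
  exact Complex.summable_ofReal.1 (by simpa only [f2] using h1.summable)

theorem hasSum_of_iterated_hasSum {f : ℕ × ℕ × ℕ → ℂ} {F : ℕ → ℕ → ℂ} {G : ℕ → ℂ} {S : ℂ}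
    (hf : Summable f) (h3 : ∀ b c, HasSum (fun a => f (b, c, a)) (F b c))
    (h2 : ∀ b, HasSum (F b) (G b)) (h1 : HasSum G S) : HasSum f S := by
  have s2 : ∀ b, HasSum (fun p : ℕ × ℕ => f (b, p)) (G b) := by
    intro b
    obtain ⟨T, hT⟩ := hf.prod_factor b
    rwa [(hT.prod_fiberwise (h3 b)).unique (h2 b)] at hT
  obtain ⟨T, hT⟩ := hf
  rwa [(hT.prod_fiberwise s2).unique h1] at hT

/-- The general term of the monomial series of the Bergman kernel of `ellipsoidIntersection q r`. -/
noncomputable def kernelTerm (q r : ℝ) (u x y : ℂ) (p : ℕ × ℕ × ℕ) : ℂ :=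
  (p.1 + 1) * (p.2.1 + 1) *
    (∏ j ∈ Finset.range (p.2.2 + 1), (2 * (p.1 + 1 : ℂ) / q + 2 * (p.2.1 + 1) / r + 1 + j)) /
    (Real.pi ^ 3 * p.2.2.factorial) * (x ^ p.1 * y ^ p.2.1 * u ^ p.2.2)

section Series

variable {q r : ℝ} {u x y : ℂ}

/-- Splitting off the first factor `s + 1` of the product leaves the binomial series of exponent `s
+ 2`. Since `s + 2 = (2 + 2/q + 2/r) + b * (2/q) + c * (2/r)` with natural `b`, `c`, the principal
power factors and its pieces are absorbed into `x ^ b` and `y ^ c`. -/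
theorem hasSum_kernelTerm_last (q r : ℝ) (x y : ℂ) (hu : ‖u‖ < 1) (b c : ℕ) :
    HasSum (fun a => kernelTerm q r u x y (b, c, a))
      (1 / (Real.pi ^ 3 * (1 - u) ^ ((2 + 2 / q + 2 / r : ℝ) : ℂ)) *
        ((b + 1) * (c + 1) * (1 + 2 / q * (b + 1) + 2 / r * (c + 1)) *
          (x / (1 - u) ^ ((2 / q : ℝ) : ℂ)) ^ b * (y / (1 - u) ^ ((2 / r : ℝ) : ℂ)) ^ c)) := by
  set s : ℂ := 2 * (b + 1 : ℂ) / q + 2 * (c + 1) / r with hs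
  have hu1 := one_sub_ne_zero_of_norm_lt_one hu
  have h := (hasSum_prod_div_factorial_mul_pow (s + 2) hu).mul_left
    ((b + 1) * (c + 1) * (s + 1) / Real.pi ^ 3 * (x ^ b * y ^ c))
  have hpow : (1 - u) ^ (s + 2) = (1 - u) ^ ((2 + 2 / q + 2 / r : ℝ) : ℂ) *
      (((1 - u) ^ ((2 / q : ℝ) : ℂ)) ^ b * ((1 - u) ^ ((2 / r : ℝ) : ℂ)) ^ c) := by
    rw [← Complex.cpow_nat_mul, ← Complex.cpow_nat_mul, ← Complex.cpow_add _ _ hu1,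
      ← Complex.cpow_add _ _ hu1, hs]
    congr 1
    push_cast
    ring
  have hval : (b + 1) * (c + 1) * (s + 1) / Real.pi ^ 3 * (x ^ b * y ^ c) *
      (1 / (1 - u) ^ (s + 2)) =
      1 / (Real.pi ^ 3 * (1 - u) ^ ((2 + 2 / q + 2 / r : ℝ) : ℂ)) *
        ((b + 1) * (c + 1) * (1 + 2 / q * (b + 1) + 2 / r * (c + 1)) *
          (x / (1 - u) ^ ((2 / q : ℝ) : ℂ)) ^ b * (y / (1 - u) ^ ((2 / r : ℝ) : ℂ)) ^ c) := by
    have hs1 : s + 1 = 1 + 2 / q * (b + 1) + 2 / r * (c + 1) := by rw [hs]; ring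
    rw [hpow, hs1, div_pow, div_pow]
    simp only [div_eq_mul_inv, mul_inv]
    ring
  rw [hval] at h
  refine h.congr_fun fun a => ?_
  have hprod : ∏ j ∈ Finset.range (a + 1), (s + 1 + (j : ℂ)) =
      (∏ j ∈ Finset.range a, (s + 2 + (j : ℂ))) * (s + 1) := by
    rw [Finset.prod_range_succ']
    congr 1
    · refine Finset.prod_congr rfl fun j _ => ?_
      push_cast; ring
    · simp
  simp only [kernelTerm]
  rw [← hs, hprod]
  simp only [div_eq_mul_inv, mul_inv]
  ring

/-- The linear factor splits into a part free of `c` and the part `β * (c + 1)`, giving the series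
of `(c + 1) Yᶜ` and `(c + 1)² Yᶜ`. -/
theorem hasSum_kernelTerm_middle (α β : ℂ) (C : ℂ) (X : ℂ) {Y : ℂ} (hY : ‖Y‖ < 1) (b : ℕ) :
    HasSum (fun c : ℕ => C * ((b + 1) * (c + 1) * (1 + α * (b + 1) + β * (c + 1)) * X ^ b * Y ^ c))
      (C * ((b + 1) * (1 + α * (b + 1)) * X ^ b / (1 - Y) ^ 2 +
        (b + 1) * X ^ b * β * ((1 + Y) / (1 - Y) ^ 3))) := by
  have h := (((hasSum_succ_mul_pow hY).mul_left ((b + 1) * (1 + α * (b + 1)) * X ^ b)).add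
    ((hasSum_succ_sq_mul_pow hY).mul_left ((b + 1) * X ^ b * β))).mul_left C
  rw [mul_one_div] at h
  refine h.congr_fun fun c => ?_
  ring

theorem hasSum_kernelTerm_first (α β : ℂ) (C : ℂ) {X : ℂ} (hX : ‖X‖ < 1) (Y : ℂ) :
    HasSum (fun b : ℕ => C * ((b + 1) * (1 + α * (b + 1)) * X ^ b / (1 - Y) ^ 2 +
        (b + 1) * X ^ b * β * ((1 + Y) / (1 - Y) ^ 3)))
      (C * ((1 / (1 - X) ^ 2 + α * ((1 + X) / (1 - X) ^ 3)) / (1 - Y) ^ 2 +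
        1 / (1 - X) ^ 2 * β * ((1 + Y) / (1 - Y) ^ 3))) := by
  have h1 := hasSum_succ_mul_pow hX
  have h2 := hasSum_succ_sq_mul_pow hX
  have h := (((h1.add (h2.mul_left α)).div_const ((1 - Y) ^ 2)).add
    (h1.mul_right (β * ((1 + Y) / (1 - Y) ^ 3)))).mul_left C
  rw [← mul_assoc (1 / (1 - X) ^ 2) β] at h
  refine h.congr_fun fun b => ?_
  ring

theorem norm_div_cpow_lt_one {s : ℝ} (hs : 0 < s) (hu : ‖u‖ < 1)
    (hx : ‖x‖ < (1 - ‖u‖) ^ (2 / s)) : ‖x / (1 - u) ^ ((2 / s : ℝ) : ℂ)‖ < 1 := by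
  have h1 : 0 < 1 - ‖u‖ := by linarith
  have h2 : 1 - ‖u‖ ≤ ‖1 - u‖ := by simpa using norm_sub_norm_le (1 : ℂ) u
  have h3 : (1 - ‖u‖) ^ (2 / s) ≤ ‖1 - u‖ ^ (2 / s) :=
    Real.rpow_le_rpow h1.le h2 (by positivity)
  rw [norm_div, Complex.norm_cpow_real, div_lt_one (Real.rpow_pos_of_pos (by linarith) _)]
  exact hx.trans_le h3

/-- The coefficients are nonnegative reals, so the series of absolute values is the same series
evaluated at the moduli. -/
theorem norm_kernelTerm (hq : 0 < q) (hr : 0 < r) (u x y : ℂ) (p : ℕ × ℕ × ℕ) :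
    (‖kernelTerm q r u x y p‖ : ℂ) = kernelTerm q r ‖u‖ ‖x‖ ‖y‖ p := by
  set t : ℝ := (p.1 + 1) * (p.2.1 + 1) *
    (∏ j ∈ Finset.range (p.2.2 + 1), (2 * (p.1 + 1 : ℝ) / q + 2 * (p.2.1 + 1) / r + 1 + j)) /
    (Real.pi ^ 3 * p.2.2.factorial) with ht
  have ht0 : 0 ≤ t := by
    have : 0 ≤ ∏ j ∈ Finset.range (p.2.2 + 1),
        (2 * (p.1 + 1 : ℝ) / q + 2 * (p.2.1 + 1) / r + 1 + j) :=
      Finset.prod_nonneg fun j _ => by positivity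
    have := Real.pi_pos
    positivity
  have h : ∀ u x y : ℂ, kernelTerm q r u x y p = t * (x ^ p.1 * y ^ p.2.1 * u ^ p.2.2) := by
    intro u x y
    rw [kernelTerm, ht]
    push_cast
    rfl
  rw [h, h, norm_mul, Complex.norm_real, Real.norm_of_nonneg ht0]
  simp

theorem hasSum_kernelTerm (hq : 0 < q) (hr : 0 < r) (hu : ‖u‖ < 1)
    (hx : ‖x‖ < (1 - ‖u‖) ^ (2 / q)) (hy : ‖y‖ < (1 - ‖u‖) ^ (2 / r)) :
    HasSum (kernelTerm q r u x y)
      (1 / (Real.pi ^ 3 * (1 - u) ^ ((2 + 2 / q + 2 / r : ℝ) : ℂ)) *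
        ((1 / (1 - x / (1 - u) ^ ((2 / q : ℝ) : ℂ)) ^ 2 + 2 / q *
          ((1 + x / (1 - u) ^ ((2 / q : ℝ) : ℂ)) / (1 - x / (1 - u) ^ ((2 / q : ℝ) : ℂ)) ^ 3)) /
          (1 - y / (1 - u) ^ ((2 / r : ℝ) : ℂ)) ^ 2 +
        1 / (1 - x / (1 - u) ^ ((2 / q : ℝ) : ℂ)) ^ 2 * (2 / r) *
          ((1 + y / (1 - u) ^ ((2 / r : ℝ) : ℂ)) /
            (1 - y / (1 - u) ^ ((2 / r : ℝ) : ℂ)) ^ 3))) := by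
  have hu' : ‖(‖u‖ : ℂ)‖ < 1 := by simpa using hu
  refine hasSum_of_iterated_hasSum ?_ (hasSum_kernelTerm_last q r x y hu)
    (hasSum_kernelTerm_middle _ _ _ _ (norm_div_cpow_lt_one hr hu hy))
    (hasSum_kernelTerm_first _ _ _ (norm_div_cpow_lt_one hq hu hx) _)
  refine summable_of_iterated_hasSum_norm (fun b c => by
      simpa only [norm_kernelTerm hq hr] using hasSum_kernelTerm_last q r ‖x‖ ‖y‖ hu' b c)
    (hasSum_kernelTerm_middle _ _ _ _ (norm_div_cpow_lt_one hr hu' (by simpa using hy)))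
    (hasSum_kernelTerm_first _ _ _ (norm_div_cpow_lt_one hq hu' (by simpa using hx)) _)

end Series

/-! ### Specialization to the domain and conclusion -/

section Ellipsoid

variable {q r : ℝ}

/-- Rests on `(1 - a²)(1 - b²) ≤ (1 - ab)²`, whose two sides differ by `(a - b)²`. It puts the pair
of points in the convergence region of the kernel series. -/
theorem norm_nu_lt_of_add_lt {s : ℝ} (hs : 0 < s) {z w : Fin 3 → ℂ} {i : Fin 3}
    (hz : ‖z 0‖ ^ 2 + ‖z i‖ ^ s < 1) (hw : ‖w 0‖ ^ 2 + ‖w i‖ ^ s < 1) :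
    ‖nu z w 0‖ < 1 ∧ ‖nu z w i‖ < (1 - ‖nu z w 0‖) ^ (2 / s) := by
  have e1 := Real.rpow_nonneg (norm_nonneg (z i)) s
  have e2 := Real.rpow_nonneg (norm_nonneg (w i)) s
  have n0 : ∀ i, ‖nu z w i‖ = ‖z i‖ * ‖w i‖ := fun i => by simp [nu]
  have h1 : ‖nu z w 0‖ < 1 := by
    rw [n0]
    nlinarith [sq_nonneg (‖z 0‖ - ‖w 0‖)]
  refine ⟨h1, ?_⟩
  have h2 : ‖nu z w i‖ ^ s < (1 - ‖nu z w 0‖) ^ (2 : ℕ) := by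
    rw [n0, n0, Real.mul_rpow (norm_nonneg _) (norm_nonneg _)]
    calc ‖z i‖ ^ s * ‖w i‖ ^ s < (1 - ‖z 0‖ ^ 2) * (1 - ‖w 0‖ ^ 2) :=
          mul_lt_mul'' (by linarith) (by linarith) e1 e2
      _ ≤ (1 - ‖z 0‖ * ‖w 0‖) ^ 2 := by nlinarith [sq_nonneg (‖z 0‖ - ‖w 0‖)]
  have h3 : (1 - ‖nu z w 0‖) ^ (2 / s) = ((1 - ‖nu z w 0‖) ^ (2 : ℕ)) ^ s⁻¹ := by
    rw [← Real.rpow_natCast, ← Real.rpow_mul (by linarith)]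
    norm_num [div_eq_mul_inv]
  rw [h3]
  exact (Real.lt_rpow_inv_iff_of_pos (norm_nonneg _) (by positivity) hs).2 h2

theorem coordMonomial_mul_conj_div_eq_kernelTerm (hq : 0 < q) (hr : 0 < r) (z w : Fin 3 → ℂ)
    (p : ℕ × ℕ × ℕ) :
    coordMonomial p z * conj (coordMonomial p w) /
      monomialNormSq (ellipsoidIntersection q r) p =
      kernelTerm q r (nu z w 0) (nu z w 1) (nu z w 2) p := by
  obtain ⟨b, c, a⟩ := p
  rw [monomialNormSq_ellipsoidIntersection hq hr]
  simp only [kernelTerm, coordMonomial, nu, map_mul, map_pow, mul_pow]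
  push_cast
  simp only [div_eq_mul_inv, mul_inv, inv_inv]
  ring

end Ellipsoid

theorem theorem2 (q r : ℝ) (hq : 0 < q) (hr : 0 < r) :
    (∀ z ∈ ellipsoidIntersection q r, ∀ w ∈ ellipsoidIntersection q r,
      0 < (1 - nu z w 0).re ∧ mu q z w 1 ≠ 1 ∧ mu r z w 2 ≠ 1) ∧
    IsBergmanKernel (ellipsoidIntersection q r) (fun z w =>
      ((q : ℂ) * r * (1 - mu q z w 1) * (1 - mu r z w 2)
          + 2 * q * (1 - mu q z w 1) * (1 + mu r z w 2)
          + 2 * r * (1 + mu q z w 1) * (1 - mu r z w 2)) /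
        ((Real.pi : ℂ) ^ 3 * q * r * (1 - nu z w 0) ^ ((2 + 2 / q + 2 / r : ℝ) : ℂ)
          * (1 - mu q z w 1) ^ 3 * (1 - mu r z w 2) ^ 3)) := by
  have hmu : ∀ z ∈ ellipsoidIntersection q r, ∀ w ∈ ellipsoidIntersection q r,
      ‖mu q z w 1‖ < 1 ∧ ‖mu r z w 2‖ < 1 := by
    intro z hz w hw
    obtain ⟨h0, h1⟩ := norm_nu_lt_of_add_lt hq hz.1 hw.1
    obtain ⟨-, h2⟩ := norm_nu_lt_of_add_lt hr hz.2 hw.2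
    exact ⟨norm_div_cpow_lt_one hq h0 h1, norm_div_cpow_lt_one hr h0 h2⟩
  refine ⟨fun z hz w hw => ⟨?_, ?_, ?_⟩, ?_⟩
  · have h1 := (norm_nu_lt_of_add_lt hq hz.1 hw.1).1
    have h2 := Complex.re_le_norm (nu z w 0)
    rw [Complex.sub_re, Complex.one_re]
    linarith
  · intro h
    simpa [h] using (hmu z hz w hw).1
  · intro h
    simpa [h] using (hmu z hz w hw).2
  · refine isBergmanKernel_of_hasSum (isOpen_ellipsoidIntersection hq hr)
      (isCompleteReinhardt_ellipsoidIntersection hq hr)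
      (fun z hz => norm_le_one_of_mem_ellipsoidIntersection hq hr hz)
      (monomialNormSq_ellipsoidIntersection_pos hq hr) fun z hz w hw => ?_
    obtain ⟨h0, h1⟩ := norm_nu_lt_of_add_lt hq hz.1 hw.1
    obtain ⟨-, h2⟩ := norm_nu_lt_of_add_lt hr hz.2 hw.2
    simp only [coordMonomial_mul_conj_div_eq_kernelTerm hq hr]
    have h := hasSum_kernelTerm hq hr h0 h1 h2
    have hX := one_sub_ne_zero_of_norm_lt_one (hmu z hz w hw).1
    have hY := one_sub_ne_zero_of_norm_lt_one (hmu z hz w hw).2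
    have hu := one_sub_ne_zero_of_norm_lt_one h0
    have hC : (1 - nu z w 0) ^ ((2 + 2 / q + 2 / r : ℝ) : ℂ) ≠ 0 := by
      rw [Complex.cpow_ne_zero_iff]
      exact Or.inl hu
    have hq' : (q : ℂ) ≠ 0 := by exact_mod_cast hq.ne'
    have hr' : (r : ℂ) ≠ 0 := by exact_mod_cast hr.ne'
    have hpi : (Real.pi : ℂ) ≠ 0 := by exact_mod_cast Real.pi_ne_zero
    have e1 : nu z w 1 / (1 - nu z w 0) ^ ((2 / q : ℝ) : ℂ) = mu q z w 1 := rfl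
    have e2 : nu z w 2 / (1 - nu z w 0) ^ ((2 / r : ℝ) : ℂ) = mu r z w 2 := rfl
    rw [e1, e2] at h
    -- Only clearing denominators remains: the three terms of the sum are brought over `q r (1 -
    -- μ₂)³ (1 - μ₃)³`.
    convert h using 1
    field_simp
    ring
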